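/- Let $\Bbbk$ be an algebraically closed field and let $\mathcal{C}$ be a finite ribbon category over $\Bbbk$: a $\Bbbk$-linear category that is equivalent, as a linear category, to the category of finite-dimensional left modules over some finite-dimensional $\Bbbk$-algebra, together with a rigid monoidal structure with $\Bbbk$-bilinear tensor product and simple tensor unit $\mathbf{1}$, a braiding $c$, and a twist, that is, a natural automorphism $\theta$ of the identity functor with $\theta_{V\otimes W}=c_{W,V}\circ c_{V,W}\circ(\theta_V\otimes\theta_W)$ and $\theta_{V^*}=(\theta_V)^*$. Let $\mathcal{L}=\int^{X\in\mathcal{C}}X^*\otimes X$ be the coend (which exists), with universal dinatural family $i_X\colon X^*\otimes X\to\mathcal{L}$, and with the following structure morphisms, in which coherence isomorphisms are suppressed and $\mathrm{ev}_X\colon X^*\otimes X\to\mathbf{1}$ is the evaluation: - the product $\mu\colon\mathcal{L}\otimes\mathcal{L}\to\mathcal{L}$, $\mu\circ(i_X\otimes i_Y)=i_{Y\otimes X}\circ(\mathrm{id}_{X^*}\otimes c_{X,\,Y^*\otimes Y})$, where $X^*\otimes Y^*\cong(Y\otimes X)^*$ canonically; - the counit $\varepsilon\colon\mathcal{L}\to\mathbf{1}$,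 $\varepsilon\circ i_X=\mathrm{ev}_X$; - the Hopf pairing $\omega\colon\mathcal{L}\otimes\mathcal{L}\to\mathbf{1}$, $\omega\circ(i_X\otimes i_Y)=(\mathrm{ev}_X\otimes\mathrm{ev}_Y)\circ(\mathrm{id}_{X^*}\otimes(c_{Y^*,X}\circ c_{X,Y^*})\otimes\mathrm{id}_Y)$; - the automorphism $\mathcal{T}$ of $\mathcal{L}$, $\mathcal{T}\circ i_X=i_X\circ(\mathrm{id}_{X^*}\otimes\theta_X)$. A right (left) integral of $\mathcal{L}$ is a morphism $\Lambda\colon\mathbf{1}\to\mathcal{L}$ with $\mu\circ(\Lambda\otimes\mathrm{id}_{\mathcal{L}})=\Lambda\circ\varepsilon$ (respectively $\mu\circ(\mathrm{id}_{\mathcal{L}}\otimes\Lambda)=\Lambda\circ\varepsilon$). Suppose that $\mathcal{C}$ is a (possibly non-semisimple) modular category, that is, that $\mathcal{C}$ is also factorizable: $\omega$ is non-degenerate, meaning that $(\omega\otimes\mathrm{id}_{\mathcal{L}^*})\circ(\mathrm{id}_{\mathcal{L}}\otimes\mathrm{coev}_{\mathcal{L}})\colon\mathcal{L}\to\mathcal{L}^*$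 is an isomorphism. Then: 1. $\mathcal{C}$ is unimodular: the tensor unit has a projective cover $P_{\mathbf{1}}$, and $P_{\mathbf{1}}^*\cong P_{\mathbf{1}}$. 2. $\mathcal{C}$ is twist non-degenerate: there is a non-zero two-sided integral of $\mathcal{L}$, and for every non-zero left or right integral $\Lambda$ of $\mathcal{L}$ there are non-zero scalars $\Delta_+,\Delta_-\in\Bbbk$ (depending on $\Lambda$) such that $\varepsilon\circ\mathcal{T}\circ\Lambda=\Delta_+\,\mathrm{id}_{\mathbf{1}}$ and $\varepsilon\circ\mathcal{T}^{-1}\circ\Lambda=\Delta_-\,\mathrm{id}_{\mathbf{1}}$. -/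

import Mathlib

set_option linter.unusedSectionVars false

open CategoryTheory MonoidalCategory Limits Opposite ExactPairing

universe v u w

noncomputable section

namespace RibbonCat

/-! ### Finite linear categories -/

/-- A `k`-linear category is finite if it is equivalent, as a `k`-linear category, to the category
of finitely generated (that is, finite-dimensional) left modules over some finite-dimensional
`k`-algebra `A`. -/
class FiniteLinearCategory (k : Type w) [Field k] (C : Type u) [Category.{v} C] [Preadditive C]
    [Linear k C] : Prop where
  exists_equivalence : ∃ (A : Type w) (_ : Ring A) (_ : Algebra k A) (_ : Module.Finite k A)
    (e : C ≌ FGModuleCat.{w} A), e.functor.Additive ∧ e.functor.Linear k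

/-! ### Twists and ribbon categories

The dual `Xᘁ` comes with `ε_ X Xᘁ : Xᘁ ⊗ X ⟶ 𝟙` and `η_ X Xᘁ : 𝟙 ⟶ X ⊗ Xᘁ`. -/

/-- A ribbon structure on a braided rigid category: a natural automorphism `twist` of the identity
functor, balanced with respect to the braiding and compatible with duals. -/
class RibbonCategory (C : Type u) [Category.{v} C] [MonoidalCategory C] [BraidedCategory C]
    [RigidCategory C] where
  /-- the twist `θ_X` -/
  twist : ∀ X : C, X ≅ X
  twist_naturality : ∀ {X Y : C} (f : X ⟶ Y), f ≫ (twist Y).hom = (twist X).hom ≫ f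
  twist_tensor : ∀ X Y : C, (twist (X ⊗ Y)).hom =
    ((twist X).hom ⊗ₘ (twist Y).hom) ≫ (β_ X Y).hom ≫ (β_ Y X).hom
  twist_dual : ∀ X : C, (twist (Xᘁ)).hom = ((twist X).hom)ᘁ

/-! ### Unimodularity -/

/-- `π : P ⟶ X` is a projective cover: `P` is projective and `π` is an essential epimorphism. -/
structure IsProjectiveCover {C : Type u} [Category.{v} C] {P X : C} (π : P ⟶ X) : Prop where
  projective : Projective P
  epi : Epi π
  essential : ∀ {Q : C} (g : Q ⟶ P), Epi (g ≫ π) → Epi g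

/-- The tensor unit has a projective cover `P`, and `P` is isomorphic to its own dual. -/
def Unimodular (C : Type u) [Category.{v} C] [MonoidalCategory C] [RigidCategory C] : Prop :=
  ∃ (P : C) (π : P ⟶ 𝟙_ C), IsProjectiveCover π ∧ Nonempty (Pᘁ ≅ P)

/-! ### Finite projective generators

These facts are only used to show that the coend below exists. -/

/-- `G` is a projective separator, every object is a quotient of a finite direct sum of copies
of `G`, and the endomorphisms of `G` are spanned by finitely many of them. -/
structure IsFiniteGenerator (k : Type w) [Field k] {C : Type u} [Category.{v} C] [Preadditive C]
    [Linear k C] (G : C) : Prop where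
  projective : Projective G
  separating : ∀ {X Y : C} (f g : X ⟶ Y), (∀ h : G ⟶ X, h ≫ f = h ≫ g) → f = g
  cover : ∀ X : C, ∃ (n : ℕ) (W : C) (π : Fin n → (W ⟶ G)) (ι : Fin n → (G ⟶ W)) (p : W ⟶ X),
    Epi p ∧ ∑ j, π j ≫ ι j = 𝟙 W
  span : ∃ (r : ℕ) (a : Fin r → (G ⟶ G)), ∀ f : G ⟶ G, ∃ c : Fin r → k, f = ∑ j, c j • a j

lemma isFiniteGenerator_fgModuleCat (k : Type w) [Field k] (A : Type w) [Ring A] [Algebra k A]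
    [Module.Finite k A] : IsFiniteGenerator k (FGModuleCat.of.{w} A A) where
  projective := by
    refine ⟨fun {E X} f e he => ?_⟩
    have he' : Function.Surjective e.hom.hom := by
      have : Epi ((forget₂ (FGModuleCat A) (ModuleCat A)).map e) := inferInstance
      exact (ModuleCat.epi_iff_surjective _).1 this
    obtain ⟨x, hx⟩ := he' (f.hom.hom 1)
    refine ⟨FGModuleCat.ofHom (LinearMap.toSpanSingleton A E x), ?_⟩
    apply FGModuleCat.hom_ext
    apply LinearMap.ext
    intro y
    change e.hom.hom ((y : A) • x) = f.hom.hom y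
    rw [map_smul, hx, ← map_smul]
    exact congrArg f.hom.hom (mul_one (y : A))
  separating := by
    intro X Y f g h
    ext x
    have := h (FGModuleCat.ofHom (LinearMap.toSpanSingleton A X x))
    have := congrArg (fun t => t.hom.hom (1 : A)) this
    change f.hom.hom ((1 : A) • x) = g.hom.hom ((1 : A) • x) at this
    simpa using this
  cover := by
    intro X
    obtain ⟨n, f, hf⟩ := Module.Finite.exists_fin' A X
    refine ⟨n, FGModuleCat.of A (Fin n → A), fun j => FGModuleCat.ofHom (LinearMap.proj j),
      fun j => FGModuleCat.ofHom (LinearMap.single A (fun _ => A) j), FGModuleCat.ofHom f, ?_, ?_⟩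
    · refine (forget₂ (FGModuleCat A) (ModuleCat A)).epi_of_epi_map ?_
      exact (ModuleCat.epi_iff_surjective _).2 hf
    · apply FGModuleCat.hom_ext
      have h1 : ∀ (s : Finset (Fin n)) (a : Fin n → (FGModuleCat.of A (Fin n → A) ⟶
          FGModuleCat.of A (Fin n → A))), (∑ j ∈ s, a j).hom.hom = ∑ j ∈ s, (a j).hom.hom := by
        intro s a
        exact map_sum (⟨⟨fun t => t.hom.hom, rfl⟩, fun _ _ => rfl⟩ :
          (FGModuleCat.of A (Fin n → A) ⟶ FGModuleCat.of A (Fin n → A)) →+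
            ((Fin n → A) →ₗ[A] (Fin n → A))) a s
      rw [h1]
      apply LinearMap.ext
      intro x
      rw [LinearMap.sum_apply]
      exact Finset.univ_sum_single x
  span := by
    obtain ⟨r, s, hs⟩ := Module.Finite.exists_fin (R := k) (M := A)
    refine ⟨r, fun j => FGModuleCat.ofHom (LinearMap.toSpanSingleton A A (s j)), fun f => ?_⟩
    have h1 : f.hom.hom 1 ∈ Submodule.span k (Set.range s) := by rw [hs]; trivial
    obtain ⟨c, hc⟩ := (Submodule.mem_span_range_iff_exists_fun k).1 h1
    refine ⟨c, ?_⟩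
    apply FGModuleCat.hom_ext
    have h1 : ∀ (u : Finset (Fin r)) (a : Fin r → (FGModuleCat.of A A ⟶ FGModuleCat.of A A)),
        (∑ j ∈ u, a j).hom.hom = ∑ j ∈ u, (a j).hom.hom := by
      intro u a
      exact map_sum (⟨⟨fun t => t.hom.hom, rfl⟩, fun _ _ => rfl⟩ :
        (FGModuleCat.of A A ⟶ FGModuleCat.of A A) →+ (A →ₗ[A] A)) a u
    rw [h1]
    apply LinearMap.ext_ring
    rw [LinearMap.sum_apply]
    change f.hom.hom 1 = ∑ j, (algebraMap k A (c j)) • ((1 : A) • s j)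
    simp only [one_smul, algebraMap_smul]
    exact hc.symm

lemma IsFiniteGenerator.of_equivalence (k : Type w) [Field k] {C : Type u} [Category.{v} C]
    [Preadditive C] [Linear k C] {D : Type*} [Category* D] [Preadditive D] [Linear k D]
    (e : C ≌ D) [e.functor.Additive] [e.functor.Linear k] {G : D} (hG : IsFiniteGenerator k G) :
    IsFiniteGenerator k (e.inverse.obj G) where
  projective := by
    have := hG.projective
    exact (e.symm.map_projective_iff G).2 this
  separating := by
    intro X Y f g h
    apply e.functor.map_injective
    apply hG.separating
    intro t
    have := congrArg e.functor.map (h (e.inverse.map t ≫ e.unitInv.app X))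
    simpa using this
  cover := by
    intro X
    have : e.inverse.Additive := inferInstance
    obtain ⟨n, W, π, ι, p, hp, hs⟩ := hG.cover (e.functor.obj X)
    refine ⟨n, e.inverse.obj W, fun j => e.inverse.map (π j), fun j => e.inverse.map (ι j),
      e.inverse.map p ≫ e.unitInv.app X, epi_comp _ _, ?_⟩
    simp only [← Functor.map_comp]
    rw [← Functor.map_sum, hs, CategoryTheory.Functor.map_id]
  span := by
    have : e.inverse.Linear k := inferInstance
    obtain ⟨r, a, ha⟩ := hG.span
    refine ⟨r, fun j => e.inverse.map (a j), fun f => ?_⟩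
    obtain ⟨c, hc⟩ := ha (e.inverse.preimage f)
    refine ⟨c, ?_⟩
    simp only [← Functor.map_smul]
    rw [← Functor.map_sum, ← hc, Functor.map_preimage]

lemma exists_abelian_generator (k : Type w) [Field k] (C : Type u) [Category.{v} C]
    [Preadditive C] [Linear k C] [FiniteLinearCategory k C] :
    ∃ (G : C), IsFiniteGenerator k G ∧ HasFiniteBiproducts C ∧ HasKernels C ∧ HasCokernels C ∧
      IsNormalEpiCategory C := by
  obtain ⟨A, _, _, _, e, _, _⟩ := FiniteLinearCategory.exists_equivalence (k := k) (C := C)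
  have : IsNoetherianRing A := isNoetherian_of_tower k inferInstance
  have h1 : HasFiniteProducts C :=
    ⟨fun _ => Adjunction.hasLimitsOfShape_of_equivalence e.functor⟩
  let hA : Abelian C := abelianOfEquivalence e.functor
  exact ⟨_, (isFiniteGenerator_fgModuleCat k A).of_equivalence k e,
    HasFiniteBiproducts.of_hasFiniteProducts, inferInstance,
    inferInstance, inferInstance⟩

/-! ### The coend and its existence -/

section Coend

variable (C : Type u) [Category.{v} C] [MonoidalCategory C] [RigidCategory C]

/-- The functor `(X, Y) ↦ Xᘁ ⊗ Y`. -/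
@[simps]
def dualTensor : Cᵒᵖ ⥤ C ⥤ C where
  obj X := tensorLeft ((X.unop)ᘁ)
  map f := { app := fun Y => (f.unop)ᘁ ▷ Y
             naturality := fun _ _ g => by simp [whisker_exchange] }
  map_id X := by ext; simp
  map_comp f g := by ext; simp [comp_rightAdjointMate]

variable {C}

section Existence

variable {k : Type w} [Field k] [Preadditive C] [Linear k C] [MonoidalPreadditive C]
  [MonoidalLinear k C]

lemma rightAdjointMate_sum {n : ℕ} {X Y : C} (f : Fin n → (X ⟶ Y)) :
    (∑ j, f j)ᘁ = ∑ j, (f j)ᘁ := by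
  simp [rightAdjointMate, whiskerLeft_sum, sum_whiskerRight, Preadditive.comp_sum,
    Preadditive.sum_comp]

lemma rightAdjointMate_smul (c : k) {X Y : C} (f : X ⟶ Y) : (c • f)ᘁ = c • fᘁ := by
  simp [rightAdjointMate]

lemma tensor_separating {G : C} (hG : IsFiniteGenerator k G) {X V Z : C} (f g : Vᘁ ⊗ X ⟶ Z)
    (h : ∀ t : G ⟶ X, (Vᘁ : C) ◁ t ≫ f = (Vᘁ : C) ◁ t ≫ g) : f = g := by
  apply (tensorLeftHomEquiv X V (Vᘁ : C) Z).injective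
  apply hG.separating
  intro t
  apply (tensorLeftHomEquiv G V (Vᘁ : C) Z).symm.injective
  simp only [tensorLeftHomEquiv_symm_naturality, Equiv.symm_apply_apply]
  exact h t

lemma exists_desc [IsNormalEpiCategory C] {G : C} (hG : IsFiniteGenerator k G)
    {W X V Z : C} (p : W ⟶ X) [Epi p] (t : Vᘁ ⊗ W ⟶ Z)
    (ht : ∀ d : G ⟶ W, d ≫ p = 0 → (Vᘁ : C) ◁ d ≫ t = 0) :
    ∃ m : Vᘁ ⊗ X ⟶ Z, (Vᘁ : C) ◁ p ≫ m = t := by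
  let N : NormalEpi p := normalEpiOfEpi p
  have h0 : N.g ≫ tensorLeftHomEquiv W V (Vᘁ : C) Z t = 0 := by
    apply hG.separating
    intro d
    have h1 := ht (d ≫ N.g) (by rw [Category.assoc, N.w, comp_zero])
    have h2 : (tensorLeftHomEquiv G V (Vᘁ : C) Z).symm 0 = 0 := by simp [tensorLeftHomEquiv]
    apply (tensorLeftHomEquiv G V (Vᘁ : C) Z).symm.injective
    rw [← Category.assoc, tensorLeftHomEquiv_symm_naturality, Equiv.symm_apply_apply, h1,
      comp_zero, h2]
  obtain ⟨m, hm⟩ := NormalEpi.desc' p _ h0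
  refine ⟨(tensorLeftHomEquiv X V (Vᘁ : C) Z).symm m, ?_⟩
  rw [← tensorLeftHomEquiv_symm_naturality, hm, Equiv.symm_apply_apply]

/-- The universal quotient of `Gᘁ ⊗ G` that is dinatural with respect to the endomorphisms
of `G`. -/
lemma exists_quotient [HasFiniteBiproducts C] [HasCokernels C] {G : C}
    (hG : IsFiniteGenerator k G) :
    ∃ (L : C) (q : Gᘁ ⊗ G ⟶ L), Epi q ∧ (∀ f : G ⟶ G, fᘁ ▷ G ≫ q = (Gᘁ : C) ◁ f ≫ q) ∧
      ∀ {Z : C} (t : Gᘁ ⊗ G ⟶ Z), (∀ f : G ⟶ G, fᘁ ▷ G ≫ t = (Gᘁ : C) ◁ f ≫ t) →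
        ∃ l : L ⟶ Z, q ≫ l = t := by
  obtain ⟨r, a, ha⟩ := hG.span
  let D : (⨁ fun _ : Fin r => (Gᘁ : C) ⊗ G) ⟶ (Gᘁ : C) ⊗ G :=
    biproduct.desc fun j => (a j)ᘁ ▷ G - (Gᘁ : C) ◁ a j
  refine ⟨cokernel D, cokernel.π D, inferInstance, fun f => ?_, fun t ht => ?_⟩
  · have h : ∀ j, (a j)ᘁ ▷ G ≫ cokernel.π D = (Gᘁ : C) ◁ a j ≫ cokernel.π D := fun j => by
      have h1 := biproduct.ι (fun _ : Fin r => (Gᘁ : C) ⊗ G) j ≫= cokernel.condition D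
      rw [biproduct.ι_desc_assoc, comp_zero, Preadditive.sub_comp, sub_eq_zero] at h1
      exact h1
    obtain ⟨c, rfl⟩ := ha f
    rw [rightAdjointMate_sum, sum_whiskerRight, whiskerLeft_sum, Preadditive.sum_comp,
      Preadditive.sum_comp]
    refine Finset.sum_congr rfl fun j _ => ?_
    rw [rightAdjointMate_smul, MonoidalLinear.smul_whiskerRight, MonoidalLinear.whiskerLeft_smul,
      Linear.smul_comp, Linear.smul_comp, h]
  · refine ⟨cokernel.desc D t ?_, cokernel.π_desc _ _ _⟩
    apply biproduct.hom_ext'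
    intro j
    rw [biproduct.ι_desc_assoc, comp_zero, Preadditive.sub_comp, ht, sub_self]

/-- A dinatural family is determined by, and can be prescribed on, a finite generator. -/
lemma exists_extension [IsNormalEpiCategory C] {G : C} (hG : IsFiniteGenerator k G) {L : C}
    (q : Gᘁ ⊗ G ⟶ L) (hq : ∀ f : G ⟶ G, fᘁ ▷ G ≫ q = (Gᘁ : C) ◁ f ≫ q) (X : C) :
    ∃ m : Xᘁ ⊗ X ⟶ L, ∀ f : G ⟶ X, (Xᘁ : C) ◁ f ≫ m = fᘁ ▷ G ≫ q := by
  obtain ⟨n, W, π, ι, p, _, hW⟩ := hG.cover X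
  let t : (Xᘁ : C) ⊗ W ⟶ L := ∑ j, (Xᘁ : C) ◁ π j ≫ (ι j ≫ p)ᘁ ▷ G ≫ q
  have ht : ∀ d : G ⟶ W, (Xᘁ : C) ◁ d ≫ t = (d ≫ p)ᘁ ▷ G ≫ q := by
    intro d
    have h1 : d ≫ p = ∑ j, (d ≫ π j) ≫ (ι j ≫ p) := by
      simp only [Category.assoc]
      rw [← Preadditive.comp_sum]
      simp only [← Category.assoc (π _)]
      rw [← Preadditive.sum_comp, hW, Category.id_comp]
    rw [h1, rightAdjointMate_sum, sum_whiskerRight, Preadditive.sum_comp, Preadditive.comp_sum]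
    refine Finset.sum_congr rfl fun j _ => ?_
    rw [← MonoidalCategory.whiskerLeft_comp_assoc, whisker_exchange_assoc, ← hq,
      comp_rightAdjointMate (f := d ≫ π j), comp_whiskerRight, Category.assoc]
  obtain ⟨m, hm⟩ := exists_desc hG p t (by
    intro d hd
    rw [ht, hd]
    simp [rightAdjointMate])
  refine ⟨m, fun f => ?_⟩
  have := hG.projective
  rw [← Projective.factorThru_comp f p, MonoidalCategory.whiskerLeft_comp, Category.assoc, hm, ht]

end Existence

/-- In a finite rigid linear category, the coend of `(X, Y) ↦ Xᘁ ⊗ Y` exists. -/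
theorem hasCoend_dualTensor (k : Type w) [Field k] (C : Type u) [Category.{v} C] [Preadditive C]
    [Linear k C] [FiniteLinearCategory k C] [MonoidalCategory C] [MonoidalPreadditive C]
    [MonoidalLinear k C] [RigidCategory C] : HasCoend (dualTensor C) := by
  obtain ⟨G, hG, _, _, _, _⟩ := exists_abelian_generator k C
  obtain ⟨L, q, _, hq, hdesc⟩ := exists_quotient hG
  choose i hi using exists_extension hG q hq
  have hdin : ∀ {X Y : C} (g : X ⟶ Y), gᘁ ▷ X ≫ i X = (Yᘁ : C) ◁ g ≫ i Y := by
    intro X Y g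
    apply tensor_separating hG
    intro f
    rw [whisker_exchange_assoc, hi, ← MonoidalCategory.whiskerLeft_comp_assoc, hi,
      comp_rightAdjointMate, comp_whiskerRight, Category.assoc]
  have hG' : i G = q := by simpa using hi G (𝟙 G)
  let c : Cowedge (dualTensor C) := Cowedge.mk L i (fun {_ _} g => hdin g)
  have hE : ∀ (E : Cowedge (dualTensor C)), ∃ l : L ⟶ E.pt, q ≫ l = E.π G := fun E =>
    hdesc (E.π G) (fun f => Cowedge.condition E f)
  choose l hl using hE
  have hfac : ∀ (E : Cowedge (dualTensor C)) (X : C), i X ≫ l E = E.π X := by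
    intro E X
    apply tensor_separating hG
    intro f
    rw [← Category.assoc, hi, Category.assoc, hl]
    exact Cowedge.condition E f
  have huniq : ∀ (E : Cowedge (dualTensor C)) (m : L ⟶ E.pt), (∀ X : C, i X ≫ m = E.π X) →
      m = l E := by
    intro E m hm
    rw [← cancel_epi q, hl, ← hG', hm]
  exact ⟨⟨c, Multicofork.IsColimit.mk c l hfac huniq⟩⟩

lemma eval_ext {W X : C} {g h : W ⟶ (Xᘁ : C)}
    (w : g ▷ X ≫ ε_ X (Xᘁ : C) = h ▷ X ≫ ε_ X (Xᘁ : C)) : g = h := by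
  have := congrArg (tensorRightHomEquiv _ X (Xᘁ : C) _) w
  simpa using this

lemma rightDualTensorIso_inv_eval (X Y : C) :
    (rightDualTensorIso X Y).inv ▷ (X ⊗ Y) ≫ ε_ (X ⊗ Y) ((X ⊗ Y)ᘁ) =
      ε_ (X ⊗ Y) (Yᘁ ⊗ (Xᘁ : C)) := by
  have := @rightAdjointMate_comp_evaluation C _ _ (X ⊗ Y) (X ⊗ Y) _
    (hasRightDualTensor) (𝟙 _)
  simp only [whiskerLeft_id] at this
  exact this.trans (Category.id_comp _)

lemma rightDualTensorIso_inv_naturality {X X' Y Y' : C} (f : X ⟶ X') (g : Y ⟶ Y') :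
    (rightDualTensorIso X' Y').inv ≫ (f ⊗ₘ g)ᘁ =
      (gᘁ ⊗ₘ fᘁ) ≫ (rightDualTensorIso X Y).inv := by
  apply eval_ext
  rw [comp_whiskerRight, Category.assoc, rightAdjointMate_comp_evaluation,
    ← whisker_exchange_assoc,
    rightDualTensorIso_inv_eval, comp_whiskerRight, Category.assoc, rightDualTensorIso_inv_eval,
    ExactPairing.tensor_evaluation, ExactPairing.tensor_evaluation]
  symm
  calc (gᘁ ⊗ₘ fᘁ) ▷ (X ⊗ Y) ≫ (𝟙 _ ⊗≫ (Yᘁ : C) ◁ (ε_ X (Xᘁ : C) ▷ Y) ⊗≫ ε_ Y (Yᘁ : C))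
      = 𝟙 _ ⊗≫ gᘁ ▷ (X'ᘁ ⊗ X ⊗ Y) ⊗≫ (Yᘁ : C) ◁ ((fᘁ ▷ X ≫ ε_ X (Xᘁ : C)) ▷ Y) ⊗≫ ε_ Y (Yᘁ : C) := by
        rw [MonoidalCategory.tensorHom_def]; monoidal
    _ = 𝟙 _ ⊗≫ (gᘁ ▷ (X'ᘁ ⊗ X ⊗ Y) ≫ (Yᘁ : C) ◁ (X'ᘁ ◁ f ▷ Y)) ⊗≫
          (Yᘁ : C) ◁ (ε_ X' (X'ᘁ : C) ▷ Y) ⊗≫ ε_ Y (Yᘁ : C) := by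
        rw [rightAdjointMate_comp_evaluation]; monoidal
    _ = 𝟙 _ ⊗≫ (Y'ᘁ : C) ◁ (X'ᘁ ◁ f ▷ Y) ⊗≫ (gᘁ ▷ ((X'ᘁ ⊗ X') ⊗ Y) ≫
          (Yᘁ : C) ◁ (ε_ X' (X'ᘁ : C) ▷ Y)) ⊗≫ ε_ Y (Yᘁ : C) := by
        rw [← whisker_exchange]; monoidal
    _ = 𝟙 _ ⊗≫ (Y'ᘁ : C) ◁ (X'ᘁ ◁ f ▷ Y) ⊗≫
          (Y'ᘁ : C) ◁ (ε_ X' (X'ᘁ : C) ▷ Y) ⊗≫ (gᘁ ▷ Y ≫ ε_ Y (Yᘁ : C)) := by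
        rw [← whisker_exchange]; monoidal
    _ = 𝟙 _ ⊗≫ (Y'ᘁ : C) ◁ (X'ᘁ ◁ f ▷ Y) ⊗≫
          (Y'ᘁ : C) ◁ (ε_ X' (X'ᘁ : C) ▷ Y ≫ 𝟙_ C ◁ g) ⊗≫ ε_ Y' (Y'ᘁ : C) := by
        rw [rightAdjointMate_comp_evaluation]; monoidal
    _ = (Y'ᘁ ⊗ (X'ᘁ : C)) ◁ (f ⊗ₘ g) ≫ (𝟙 _ ⊗≫ (Y'ᘁ : C) ◁ (ε_ X' (X'ᘁ : C) ▷ Y') ⊗≫ ε_ Y' (Y'ᘁ : C)) := by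
        rw [← whisker_exchange, MonoidalCategory.tensorHom_def]; monoidal

variable (C) [HasCoend (dualTensor C)]

/-- The coend `∫^X Xᘁ ⊗ X`. -/
abbrev coendObj : C := coend (dualTensor C)

variable {C}

/-- The universal dinatural family `i_X : Xᘁ ⊗ X ⟶ ∫^X Xᘁ ⊗ X`. -/
def coendι (X : C) : Xᘁ ⊗ X ⟶ coendObj C := coend.ι (dualTensor C) X

lemma coendι_dinatural {X Y : C} (f : X ⟶ Y) :
    fᘁ ▷ X ≫ coendι X = Yᘁ ◁ f ≫ coendι Y :=
  coend.condition (dualTensor C) f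

lemma coend_hom_ext {Z : C} {g h : coendObj C ⟶ Z} (w : ∀ X : C, coendι X ≫ g = coendι X ≫ h) :
    g = h :=
  coend.hom_ext w

/-- The morphism out of the coend induced by a dinatural family. -/
def coendDesc {Z : C} (f : ∀ X : C, Xᘁ ⊗ X ⟶ Z)
    (hf : ∀ {X Y : C} (g : X ⟶ Y), gᘁ ▷ X ≫ f X = Yᘁ ◁ g ≫ f Y) : coendObj C ⟶ Z :=
  coend.desc f (fun _ _ g => hf g)

lemma coendι_desc {Z : C} (f : ∀ X : C, Xᘁ ⊗ X ⟶ Z)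
    (hf : ∀ {X Y : C} (g : X ⟶ Y), gᘁ ▷ X ≫ f X = Yᘁ ◁ g ≫ f Y) (X : C) :
    coendι X ≫ coendDesc f hf = f X := by
  unfold coendι coendDesc
  exact coend.ι_desc (F := dualTensor C) (X := Z) f _ X

lemma coend_hom_ext₂ {Z : C} {g h : coendObj C ⊗ coendObj C ⟶ Z}
    (w : ∀ X Y : C, (coendι X ⊗ₘ coendι Y) ≫ g = (coendι X ⊗ₘ coendι Y) ≫ h) : g = h := by
  apply (tensorLeftHomEquiv _ (ᘁ(coendObj C)) (coendObj C) Z).injective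
  apply coend_hom_ext
  intro Y
  apply (tensorLeftHomEquiv _ (ᘁ(coendObj C)) (coendObj C) Z).symm.injective
  simp only [tensorLeftHomEquiv_symm_naturality, Equiv.symm_apply_apply]
  apply (tensorRightHomEquiv _ (Yᘁ ⊗ Y) ((Yᘁ ⊗ Y)ᘁ) Z).injective
  apply coend_hom_ext
  intro X
  apply (tensorRightHomEquiv _ (Yᘁ ⊗ Y) ((Yᘁ ⊗ Y)ᘁ) Z).symm.injective
  simp only [tensorRightHomEquiv_symm_naturality, Equiv.symm_apply_apply]
  have := w X Y
  simp only [MonoidalCategory.tensorHom_def, Category.assoc] at this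
  exact this

section Desc₂

variable {Z : C} (f : ∀ X Y : C, (Xᘁ ⊗ X) ⊗ (Yᘁ ⊗ Y) ⟶ Z)
  (hf₁ : ∀ {X X' : C} (Y : C) (g : X ⟶ X'),
    (gᘁ ▷ X) ▷ (Yᘁ ⊗ Y) ≫ f X Y = (X'ᘁ ◁ g) ▷ (Yᘁ ⊗ Y) ≫ f X' Y)
  (hf₂ : ∀ (X : C) {Y Y' : C} (g : Y ⟶ Y'),
    (Xᘁ ⊗ X) ◁ (gᘁ ▷ Y) ≫ f X Y = (Xᘁ ⊗ X) ◁ (Y'ᘁ ◁ g) ≫ f X Y')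

lemma coendDescLeft_dinatural {X X' : C} (Y : C) (hf₁ : ∀ {X X' : C} (Y : C) (g : X ⟶ X'),
    (gᘁ ▷ X) ▷ (Yᘁ ⊗ Y) ≫ f X Y = (X'ᘁ ◁ g) ▷ (Yᘁ ⊗ Y) ≫ f X' Y) (g : X ⟶ X') :
    gᘁ ▷ X ≫ tensorRightHomEquiv _ (Yᘁ ⊗ Y) ((Yᘁ ⊗ Y)ᘁ) Z (f X Y) =
      X'ᘁ ◁ g ≫ tensorRightHomEquiv _ (Yᘁ ⊗ Y) ((Yᘁ ⊗ Y)ᘁ) Z (f X' Y) := by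
  apply (tensorRightHomEquiv _ (Yᘁ ⊗ Y) ((Yᘁ ⊗ Y)ᘁ) Z).symm.injective
  simp only [tensorRightHomEquiv_symm_naturality, Equiv.symm_apply_apply]
  exact hf₁ Y g

/-- Auxiliary to `coendDesc₂`: the morphism induced by `f - Y` in the first variable. -/
def coendDescLeft (Y : C) : coendObj C ⊗ (Yᘁ ⊗ Y) ⟶ Z :=
  (tensorRightHomEquiv _ (Yᘁ ⊗ Y) ((Yᘁ ⊗ Y)ᘁ) Z).symm
    (coendDesc (fun X => tensorRightHomEquiv _ (Yᘁ ⊗ Y) ((Yᘁ ⊗ Y)ᘁ) Z (f X Y)) (coendDescLeft_dinatural f Y hf₁))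

lemma coendι_descLeft (X Y : C) :
    coendι X ▷ (Yᘁ ⊗ Y) ≫ coendDescLeft f hf₁ Y = f X Y := by
  unfold coendDescLeft
  rw [← tensorRightHomEquiv_symm_naturality, coendι_desc, Equiv.symm_apply_apply]
  exact fun g => coendDescLeft_dinatural f Y hf₁ g

lemma coendDesc₂_dinatural (hf₂ : ∀ (X : C) {Y Y' : C} (g : Y ⟶ Y'),
    (Xᘁ ⊗ X) ◁ (gᘁ ▷ Y) ≫ f X Y = (Xᘁ ⊗ X) ◁ (Y'ᘁ ◁ g) ≫ f X Y') {Y Y' : C} (g : Y ⟶ Y') :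
    gᘁ ▷ Y ≫ tensorLeftHomEquiv _ (ᘁ(coendObj C)) (coendObj C) Z (coendDescLeft f hf₁ Y) =
      Y'ᘁ ◁ g ≫
        tensorLeftHomEquiv _ (ᘁ(coendObj C)) (coendObj C) Z (coendDescLeft f hf₁ Y') := by
  apply (tensorLeftHomEquiv _ (ᘁ(coendObj C)) (coendObj C) Z).symm.injective
  simp only [tensorLeftHomEquiv_symm_naturality, Equiv.symm_apply_apply]
  apply (tensorRightHomEquiv _ (Y'ᘁ ⊗ Y) ((Y'ᘁ ⊗ Y)ᘁ) Z).injective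
  apply coend_hom_ext
  intro X
  apply (tensorRightHomEquiv _ (Y'ᘁ ⊗ Y) ((Y'ᘁ ⊗ Y)ᘁ) Z).symm.injective
  simp only [tensorRightHomEquiv_symm_naturality, Equiv.symm_apply_apply]
  rw [← whisker_exchange_assoc, ← whisker_exchange_assoc, coendι_descLeft, coendι_descLeft]
  exact hf₂ X g

/-- The morphism out of the tensor square of the coend induced by a family that is dinatural
in both variables; see `coendι_desc₂` and `coend_hom_ext₂` for its universal property. -/
def coendDesc₂ : coendObj C ⊗ coendObj C ⟶ Z :=
  (tensorLeftHomEquiv _ (ᘁ(coendObj C)) (coendObj C) Z).symm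
    (coendDesc (fun Y => tensorLeftHomEquiv _ (ᘁ(coendObj C)) (coendObj C) Z
      (coendDescLeft f hf₁ Y)) (fun g => coendDesc₂_dinatural f hf₁ hf₂ g))

lemma coendι_desc₂ (X Y : C) :
    (coendι X ⊗ₘ coendι Y) ≫ coendDesc₂ f hf₁ hf₂ = f X Y := by
  unfold coendDesc₂
  rw [MonoidalCategory.tensorHom_def, Category.assoc, ← tensorLeftHomEquiv_symm_naturality,
    coendι_desc _ (fun g => coendDesc₂_dinatural f hf₁ hf₂ g), Equiv.symm_apply_apply,
    coendι_descLeft]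

end Desc₂

/-- The counit of the coend: `i_X ≫ counit` is the evaluation `Xᘁ ⊗ X ⟶ 𝟙`. -/
def coendCounit : coendObj C ⟶ 𝟙_ C :=
  coendDesc (fun X => ε_ X (Xᘁ : C)) (fun g => rightAdjointMate_comp_evaluation g)

variable [BraidedCategory C]

/-- The composite of `𝟙 ⊗ (double braiding of X and Yᘁ) ⊗ 𝟙` with the two evaluations. -/
def hopfPairingFamily (X Y : C) : (Xᘁ ⊗ X) ⊗ (Yᘁ ⊗ Y) ⟶ 𝟙_ C :=
  𝟙 _ ⊗≫ (Xᘁ : C) ◁ ((β_ X (Yᘁ : C)).hom ≫ (β_ (Yᘁ : C) X).hom) ▷ Y ⊗≫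
    (ε_ X (Xᘁ : C) ⊗ₘ ε_ Y (Yᘁ : C)) ≫ (λ_ (𝟙_ C)).hom

/-- Move `X` across `Yᘁ ⊗ Y` with the braiding, identify `Xᘁ ⊗ Yᘁ` with `(Y ⊗ X)ᘁ`, and include
into the coend. -/
def coendMulFamily (X Y : C) : (Xᘁ ⊗ X) ⊗ (Yᘁ ⊗ Y) ⟶ coendObj C :=
  𝟙 _ ⊗≫ (Xᘁ : C) ◁ (β_ X (Yᘁ ⊗ Y)).hom ⊗≫ (rightDualTensorIso Y X).inv ▷ (Y ⊗ X) ≫ coendι (Y ⊗ X)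

lemma hopfPairingFamily_left {X X' : C} (Y : C) (g : X ⟶ X') :
    (gᘁ ▷ X) ▷ (Yᘁ ⊗ Y) ≫ hopfPairingFamily X Y = (X'ᘁ ◁ g) ▷ (Yᘁ ⊗ Y) ≫ hopfPairingFamily X' Y := by
  unfold hopfPairingFamily
  calc gᘁ ▷ X ▷ (Yᘁ ⊗ Y) ≫ (𝟙 _ ⊗≫ (Xᘁ : C) ◁ ((β_ X (Yᘁ : C)).hom ≫ (β_ (Yᘁ : C) X).hom) ▷ Y ⊗≫
        (ε_ X (Xᘁ : C) ⊗ₘ ε_ Y (Yᘁ : C)) ≫ (λ_ (𝟙_ C)).hom)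
      = 𝟙 _ ⊗≫ (gᘁ ▷ (X ⊗ (Yᘁ : C)) ≫ (Xᘁ : C) ◁ ((β_ X (Yᘁ : C)).hom ≫ (β_ (Yᘁ : C) X).hom)) ▷ Y ⊗≫
        (ε_ X (Xᘁ : C) ⊗ₘ ε_ Y (Yᘁ : C)) ≫ (λ_ (𝟙_ C)).hom := by monoidal
    _ = 𝟙 _ ⊗≫ (X'ᘁ : C) ◁ ((β_ X (Yᘁ : C)).hom ≫ (β_ (Yᘁ : C) X).hom) ▷ Y ⊗≫
        ((gᘁ ▷ X ≫ ε_ X (Xᘁ : C)) ⊗ₘ ε_ Y (Yᘁ : C)) ≫ (λ_ (𝟙_ C)).hom := by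
      rw [← whisker_exchange, MonoidalCategory.tensorHom_def, MonoidalCategory.tensorHom_def]
      monoidal
    _ = 𝟙 _ ⊗≫ (X'ᘁ : C) ◁ ((β_ X (Yᘁ : C)).hom ≫ (β_ (Yᘁ : C) X).hom ≫ g ▷ (Yᘁ : C)) ▷ Y ⊗≫
        (ε_ X' (X'ᘁ : C) ⊗ₘ ε_ Y (Yᘁ : C)) ≫ (λ_ (𝟙_ C)).hom := by
      rw [rightAdjointMate_comp_evaluation, MonoidalCategory.tensorHom_def,
        MonoidalCategory.tensorHom_def]
      monoidal
    _ = 𝟙 _ ⊗≫ (X'ᘁ : C) ◁ (g ▷ (Yᘁ : C) ≫ (β_ X' (Yᘁ : C)).hom ≫ (β_ (Yᘁ : C) X').hom) ▷ Y ⊗≫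
        (ε_ X' (X'ᘁ : C) ⊗ₘ ε_ Y (Yᘁ : C)) ≫ (λ_ (𝟙_ C)).hom := by
      rw [BraidedCategory.braiding_naturality_left_assoc,
        BraidedCategory.braiding_naturality_right]
    _ = _ := by monoidal

lemma hopfPairingFamily_right (X : C) {Y Y' : C} (g : Y ⟶ Y') :
    (Xᘁ ⊗ X) ◁ (gᘁ ▷ Y) ≫ hopfPairingFamily X Y = (Xᘁ ⊗ X) ◁ (Y'ᘁ ◁ g) ≫ hopfPairingFamily X Y' := by
  unfold hopfPairingFamily
  calc (Xᘁ ⊗ X) ◁ (gᘁ ▷ Y) ≫ (𝟙 _ ⊗≫ (Xᘁ : C) ◁ ((β_ X (Yᘁ : C)).hom ≫ (β_ (Yᘁ : C) X).hom) ▷ Y ⊗≫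
        (ε_ X (Xᘁ : C) ⊗ₘ ε_ Y (Yᘁ : C)) ≫ (λ_ (𝟙_ C)).hom)
      = 𝟙 _ ⊗≫ (Xᘁ : C) ◁ (X ◁ gᘁ ≫ (β_ X (Yᘁ : C)).hom ≫ (β_ (Yᘁ : C) X).hom) ▷ Y ⊗≫
        (ε_ X (Xᘁ : C) ⊗ₘ ε_ Y (Yᘁ : C)) ≫ (λ_ (𝟙_ C)).hom := by monoidal
    _ = 𝟙 _ ⊗≫ (Xᘁ : C) ◁ ((β_ X (Y'ᘁ : C)).hom ≫ (β_ (Y'ᘁ : C) X).hom ≫ X ◁ gᘁ) ▷ Y ⊗≫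
        (ε_ X (Xᘁ : C) ⊗ₘ ε_ Y (Yᘁ : C)) ≫ (λ_ (𝟙_ C)).hom := by
      rw [BraidedCategory.braiding_naturality_right_assoc,
        BraidedCategory.braiding_naturality_left]
    _ = 𝟙 _ ⊗≫ (Xᘁ : C) ◁ ((β_ X (Y'ᘁ : C)).hom ≫ (β_ (Y'ᘁ : C) X).hom) ▷ Y ⊗≫
        (ε_ X (Xᘁ : C) ⊗ₘ (gᘁ ▷ Y ≫ ε_ Y (Yᘁ : C))) ≫ (λ_ (𝟙_ C)).hom := by
      rw [MonoidalCategory.tensorHom_def', MonoidalCategory.tensorHom_def']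
      monoidal
    _ = 𝟙 _ ⊗≫ ((Xᘁ : C) ◁ ((β_ X (Y'ᘁ : C)).hom ≫ (β_ (Y'ᘁ : C) X).hom)) ▷ Y ⊗≫
        (((Xᘁ ⊗ X) ⊗ (Y'ᘁ : C)) ◁ g) ⊗≫
        (ε_ X (Xᘁ : C) ⊗ₘ (ε_ Y' (Y'ᘁ : C))) ≫ (λ_ (𝟙_ C)).hom := by
      rw [rightAdjointMate_comp_evaluation, MonoidalCategory.tensorHom_def',
        MonoidalCategory.tensorHom_def']
      monoidal
    _ = 𝟙 _ ⊗≫ (((Xᘁ : C) ◁ ((β_ X (Y'ᘁ : C)).hom ≫ (β_ (Y'ᘁ : C) X).hom)) ▷ Y ≫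
        (((Xᘁ : C) ⊗ (X ⊗ (Y'ᘁ : C))) ◁ g)) ⊗≫
        (ε_ X (Xᘁ : C) ⊗ₘ (ε_ Y' (Y'ᘁ : C))) ≫ (λ_ (𝟙_ C)).hom := by monoidal
    _ = _ := by
      rw [← whisker_exchange]
      monoidal

/-- The Hopf pairing `ω` on the coend. -/
def hopfPairing : coendObj C ⊗ coendObj C ⟶ 𝟙_ C :=
  coendDesc₂ hopfPairingFamily hopfPairingFamily_left hopfPairingFamily_right

lemma coendMulFamily_left {X X' : C} (Y : C) (g : X ⟶ X') :
    (gᘁ ▷ X) ▷ (Yᘁ ⊗ Y) ≫ coendMulFamily X Y = (X'ᘁ ◁ g) ▷ (Yᘁ ⊗ Y) ≫ coendMulFamily X' Y := by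
  unfold coendMulFamily
  have h := rightDualTensorIso_inv_naturality (𝟙 Y) g
  simp only [rightAdjointMate_id, id_tensorHom, tensorHom_id] at h
  calc gᘁ ▷ X ▷ (Yᘁ ⊗ Y) ≫ (𝟙 _ ⊗≫ (Xᘁ : C) ◁ (β_ X (Yᘁ ⊗ Y)).hom ⊗≫
        (rightDualTensorIso Y X).inv ▷ (Y ⊗ X) ≫ coendι (Y ⊗ X))
      = 𝟙 _ ⊗≫ (gᘁ ▷ (X ⊗ ((Yᘁ : C) ⊗ Y)) ≫ (Xᘁ : C) ◁ (β_ X (Yᘁ ⊗ Y)).hom) ⊗≫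
        (rightDualTensorIso Y X).inv ▷ (Y ⊗ X) ≫ coendι (Y ⊗ X) := by monoidal
    _ = 𝟙 _ ⊗≫ (X'ᘁ : C) ◁ (β_ X (Yᘁ ⊗ Y)).hom ⊗≫
        (gᘁ ▷ (Yᘁ : C) ≫ (rightDualTensorIso Y X).inv) ▷ (Y ⊗ X) ≫ coendι (Y ⊗ X) := by
      rw [← whisker_exchange]; monoidal
    _ = 𝟙 _ ⊗≫ (X'ᘁ : C) ◁ (β_ X (Yᘁ ⊗ Y)).hom ⊗≫
        (rightDualTensorIso Y X').inv ▷ (Y ⊗ X) ≫ (Y ◁ g)ᘁ ▷ (Y ⊗ X) ≫ coendι (Y ⊗ X) := by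
      rw [← h]; monoidal
    _ = 𝟙 _ ⊗≫ (X'ᘁ : C) ◁ (β_ X (Yᘁ ⊗ Y)).hom ⊗≫
        ((rightDualTensorIso Y X').inv ▷ (Y ⊗ X) ≫ _ ◁ (Y ◁ g)) ≫ coendι (Y ⊗ X') := by
      rw [coendι_dinatural]; monoidal
    _ = 𝟙 _ ⊗≫ (X'ᘁ : C) ◁ ((β_ X (Yᘁ ⊗ Y)).hom ≫ (Yᘁ ⊗ Y) ◁ g) ⊗≫
        (rightDualTensorIso Y X').inv ▷ (Y ⊗ X') ≫ coendι (Y ⊗ X') := by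
      rw [← whisker_exchange]; monoidal
    _ = _ := by
      rw [← BraidedCategory.braiding_naturality_left]; monoidal

lemma coendMulFamily_right (X : C) {Y Y' : C} (g : Y ⟶ Y') :
    (Xᘁ ⊗ X) ◁ (gᘁ ▷ Y) ≫ coendMulFamily X Y = (Xᘁ ⊗ X) ◁ (Y'ᘁ ◁ g) ≫ coendMulFamily X Y' := by
  unfold coendMulFamily
  have h := rightDualTensorIso_inv_naturality g (𝟙 X)
  simp only [rightAdjointMate_id, id_tensorHom, tensorHom_id] at h
  calc (Xᘁ ⊗ X) ◁ (gᘁ ▷ Y) ≫ (𝟙 _ ⊗≫ (Xᘁ : C) ◁ (β_ X (Yᘁ ⊗ Y)).hom ⊗≫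
        (rightDualTensorIso Y X).inv ▷ (Y ⊗ X) ≫ coendι (Y ⊗ X))
      = 𝟙 _ ⊗≫ (Xᘁ : C) ◁ (X ◁ (gᘁ ▷ Y) ≫ (β_ X (Yᘁ ⊗ Y)).hom) ⊗≫
        (rightDualTensorIso Y X).inv ▷ (Y ⊗ X) ≫ coendι (Y ⊗ X) := by monoidal
    _ = 𝟙 _ ⊗≫ (Xᘁ : C) ◁ (β_ X (Y'ᘁ ⊗ Y)).hom ⊗≫
        (Xᘁ ◁ gᘁ ≫ (rightDualTensorIso Y X).inv) ▷ (Y ⊗ X) ≫ coendι (Y ⊗ X) := by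
      rw [BraidedCategory.braiding_naturality_right]; monoidal
    _ = 𝟙 _ ⊗≫ (Xᘁ : C) ◁ (β_ X (Y'ᘁ ⊗ Y)).hom ⊗≫
        (rightDualTensorIso Y' X).inv ▷ (Y ⊗ X) ≫ (g ▷ X)ᘁ ▷ (Y ⊗ X) ≫ coendι (Y ⊗ X) := by
      rw [← h]; monoidal
    _ = 𝟙 _ ⊗≫ (Xᘁ : C) ◁ (β_ X (Y'ᘁ ⊗ Y)).hom ⊗≫
        ((rightDualTensorIso Y' X).inv ▷ (Y ⊗ X) ≫ _ ◁ (g ▷ X)) ≫ coendι (Y' ⊗ X) := by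
      rw [coendι_dinatural]; monoidal
    _ = 𝟙 _ ⊗≫ (Xᘁ : C) ◁ ((β_ X (Y'ᘁ ⊗ Y)).hom ≫ (Y'ᘁ ◁ g) ▷ X) ⊗≫
        (rightDualTensorIso Y' X).inv ▷ (Y' ⊗ X) ≫ coendι (Y' ⊗ X) := by
      rw [← whisker_exchange]; monoidal
    _ = _ := by
      rw [← BraidedCategory.braiding_naturality_right]; monoidal

/-- The product of the coend. -/
def coendMul : coendObj C ⊗ coendObj C ⟶ coendObj C :=
  coendDesc₂ coendMulFamily coendMulFamily_left coendMulFamily_right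

/-- A morphism `L ⊗ L ⟶ 𝟙` seen as a morphism `L ⟶ Lᘁ`. -/
def pairingToDual {L : C} (p : L ⊗ L ⟶ 𝟙_ C) : L ⟶ (Lᘁ : C) :=
  (ρ_ L).inv ≫ L ◁ η_ L (Lᘁ : C) ≫ (α_ L L (Lᘁ : C)).inv ≫ p ▷ (Lᘁ : C) ≫ (λ_ (Lᘁ : C)).hom

/-- `Λ : 𝟙 ⟶ ∫^X Xᘁ ⊗ X` is a right integral: `μ ∘ (Λ ⊗ id) = Λ ∘ ε`. -/
def IsRightIntegral (Λ : 𝟙_ C ⟶ coendObj C) : Prop :=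
  Λ ▷ coendObj C ≫ coendMul = (λ_ (coendObj C)).hom ≫ coendCounit ≫ Λ

/-- `Λ : 𝟙 ⟶ ∫^X Xᘁ ⊗ X` is a left integral: `μ ∘ (id ⊗ Λ) = Λ ∘ ε`. -/
def IsLeftIntegral (Λ : 𝟙_ C ⟶ coendObj C) : Prop :=
  coendObj C ◁ Λ ≫ coendMul = (ρ_ (coendObj C)).hom ≫ coendCounit ≫ Λ

variable [RibbonCategory C]

lemma coendTwist_dinatural {X Y : C} (g : X ⟶ Y) :
    gᘁ ▷ X ≫ (Xᘁ : C) ◁ (RibbonCategory.twist X).hom ≫ coendι X =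
      (Yᘁ : C) ◁ g ≫ (Yᘁ : C) ◁ (RibbonCategory.twist Y).hom ≫ coendι Y := by
  rw [← whisker_exchange_assoc, coendι_dinatural, ← MonoidalCategory.whiskerLeft_comp_assoc,
    ← MonoidalCategory.whiskerLeft_comp_assoc, RibbonCategory.twist_naturality]

lemma coendTwistInv_dinatural {X Y : C} (g : X ⟶ Y) :
    gᘁ ▷ X ≫ (Xᘁ : C) ◁ (RibbonCategory.twist X).inv ≫ coendι X =
      (Yᘁ : C) ◁ g ≫ (Yᘁ : C) ◁ (RibbonCategory.twist Y).inv ≫ coendι Y := by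
  have h : (RibbonCategory.twist X).inv ≫ g = g ≫ (RibbonCategory.twist Y).inv := by
    rw [Iso.inv_comp_eq, ← Category.assoc, Iso.eq_comp_inv, RibbonCategory.twist_naturality]
  rw [← whisker_exchange_assoc, coendι_dinatural, ← MonoidalCategory.whiskerLeft_comp_assoc,
    ← MonoidalCategory.whiskerLeft_comp_assoc, h]

/-- The `T`-transformation of the coend, `i_X ≫ T = (𝟙 ⊗ θ_X) ≫ i_X`, with its inverse. -/
def coendTwist : coendObj C ≅ coendObj C where
  hom := coendDesc (fun X => (Xᘁ : C) ◁ (RibbonCategory.twist X).hom ≫ coendι X)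
    coendTwist_dinatural
  inv := coendDesc (fun X => (Xᘁ : C) ◁ (RibbonCategory.twist X).inv ≫ coendι X)
    coendTwistInv_dinatural
  hom_inv_id := by
    apply coend_hom_ext
    intro X
    rw [← Category.assoc, coendι_desc, Category.assoc, coendι_desc,
      ← MonoidalCategory.whiskerLeft_comp_assoc, Iso.hom_inv_id]
    simp
  inv_hom_id := by
    apply coend_hom_ext
    intro X
    rw [← Category.assoc, coendι_desc, Category.assoc, coendι_desc,
      ← MonoidalCategory.whiskerLeft_comp_assoc, Iso.inv_hom_id]
    simp

end Coend

/-! ### Factorizability and twist non-degeneracy -/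

section Main

variable (k : Type w) [Field k] (C : Type u) [Category.{v} C] [Preadditive C] [Linear k C]
  [FiniteLinearCategory k C] [MonoidalCategory C] [MonoidalPreadditive C] [MonoidalLinear k C]
  [RigidCategory C] [BraidedCategory C]

/-- The Hopf pairing of the coend is non-degenerate. -/
def Factorizable : Prop :=
  haveI := hasCoend_dualTensor k C
  IsIso (pairingToDual (hopfPairing (C := C)))

/-- There is a non-zero integral of the coend, and `ε ∘ T ∘ Λ` and `ε ∘ T⁻¹ ∘ Λ` are non-zero
multiples of the identity of the tensor unit for every non-zero integral `Λ` of the coend. The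
integral that exists is two-sided, and the second clause covers one-sided ones too. -/
def TwistNondegenerate [RibbonCategory C] : Prop :=
  haveI := hasCoend_dualTensor k C
  (∃ Λ : 𝟙_ C ⟶ coendObj C, Λ ≠ 0 ∧ IsRightIntegral Λ ∧ IsLeftIntegral Λ) ∧
  ∀ Λ : 𝟙_ C ⟶ coendObj C, Λ ≠ 0 → (IsRightIntegral Λ ∨ IsLeftIntegral Λ) →
    ∃ Δp Δm : k, Δp ≠ 0 ∧ Δm ≠ 0 ∧
      Λ ≫ coendTwist.hom ≫ coendCounit = Δp • 𝟙 (𝟙_ C) ∧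
      Λ ≫ coendTwist.inv ≫ coendCounit = Δm • 𝟙 (𝟙_ C)

end Main

end RibbonCat

end

/-! Write `L` for the coend. It acts naturally on every object `W` by encircling (`encircle`): the
product of `L` becomes composition (`encircle_mul`) and the action on the unit is the counit.
Closing up the action on `Vᘁ` with an evaluation gives the Hopf pairing against `coendι V`. Hence,
when the pairing is non-degenerate, every natural family `K ⊗ W ⟶ W` is the action of some `K ⟶ L`
on the objects `Vᘁ` (`exists_encircle_eq`), and that action determines the morphism
(`encircle_ext`).

Let `π : P ⟶ 𝟙` be a projective cover and `ι : D ⟶ P` a simple subobject. Projectives are injective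
in a rigid abelian category, so `ι` is killed by every morphism out of `P` that vanishes after all
morphisms to the unit. This makes a natural family `D ⊗ W ⟶ W` out of a basis of `W ⟶ 𝟙` and dual
lifts `P ⟶ W`, and it is non-zero at `P` (`exists_natural`). It comes from a non-zero `Λ : D ⟶ L`;
since it factors through copies of the unit, `Λ` is a right integral with source `D`, and a left one
too when `D = 𝟙`.

The balancing axiom turns the pairing `ε ∘ T⁻¹ ∘ μ` into the Hopf pairing, up to twisting both
arguments (`twist_tensor_mul_twist_inv`). On a right integral `Λ` it only sees `ε ∘ T⁻¹ ∘ Λ`, so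
this composite cannot vanish unless `Λ` does. It is therefore a non-zero map between the simple
objects `D` and `𝟙`, so `𝟙` embeds into `P`. Dualizing the embedding gives an epimorphism `Pᘁ ⟶ 𝟙`,
and comparing it with `π` yields `Pᘁ ≅ P`.

With `D = 𝟙` the integral is two-sided. Every left integral is a multiple of it, so only right
integrals need the non-vanishing of both scalars; for `ε ∘ T ∘ Λ` it follows from the encircling
form of `ε ∘ T ∘ μ` (`twistInv_tensor_mul_twist`). -/

noncomputable section

namespace RibbonCat

/-! ### Sliding a strand past a cap. -/

section Braiding

variable {C : Type u} [Category.{v} C] [MonoidalCategory C] [BraidedCategory C]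

/-- Naturality of the braiding at `e`, since braiding with the unit is trivial: a strand may pass
under a cap. -/
lemma braiding_slide_left {A B : C} (e : A ⊗ B ⟶ 𝟙_ C) (X : C) :
    e ▷ X = 𝟙 _ ⊗≫ A ◁ (β_ B X).hom ⊗≫ (β_ A X).hom ▷ B ⊗≫ X ◁ e ⊗≫ 𝟙 _ := by
  have h := BraidedCategory.braiding_naturality_left e X
  rw [braiding_tensorUnit_left, BraidedCategory.braiding_tensor_left_hom] at h
  calc e ▷ X = (e ▷ X ≫ (λ_ X).hom ≫ (ρ_ X).inv) ⊗≫ 𝟙 _ := by monoidal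
    _ = _ := by rw [h]; monoidal

lemma braiding_slide_right {A B : C} (e : A ⊗ B ⟶ 𝟙_ C) (X : C) :
    X ◁ e = 𝟙 _ ⊗≫ (β_ X A).hom ▷ B ⊗≫ A ◁ (β_ X B).hom ⊗≫ e ▷ X ⊗≫ 𝟙 _ := by
  have h := BraidedCategory.braiding_naturality_right X e
  rw [braiding_tensorUnit_right, BraidedCategory.braiding_tensor_right_hom] at h
  calc X ◁ e = (X ◁ e ≫ (ρ_ X).hom ≫ (λ_ X).inv) ⊗≫ 𝟙 _ := by monoidal
    _ = _ := by rw [h]; monoidal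

/-- The inverse double braiding cancels the crossing of `X` with `B` and leaves the opposite one;
pulling the cap across `X` moves that crossing onto `A`. -/
lemma monodromy_slide {A B : C} (e : A ⊗ B ⟶ 𝟙_ C) (X : C) :
    (β_ X (A ⊗ B)).hom ⊗≫ A ◁ ((β_ X B).inv ≫ (β_ B X).inv) ⊗≫ e ▷ X =
      𝟙 _ ⊗≫ ((β_ X A).hom ≫ (β_ A X).hom) ▷ B ⊗≫ X ◁ e ⊗≫ 𝟙 _ := by
  rw [braiding_slide_left e X, BraidedCategory.braiding_tensor_right_hom]
  calc _ = 𝟙 _ ⊗≫ (β_ X A).hom ▷ B ⊗≫ A ◁ ((β_ X B).hom ≫ (β_ X B).inv ≫ (β_ B X).inv ≫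
          (β_ B X).hom) ⊗≫ (β_ A X).hom ▷ B ⊗≫ X ◁ e ⊗≫ 𝟙 _ := by monoidal
    _ = _ := by simp only [Iso.hom_inv_id_assoc, Iso.inv_hom_id]; monoidal

/-- Here the double braiding does not cancel. The Yang–Baxter relation carries the crossing of `A`
and `B` past `X`, after which `X` winds around `B` and is free of the cap. -/
lemma monodromy_flip {A B : C} (e : A ⊗ B ⟶ 𝟙_ C) (X : C) :
    X ◁ (β_ B A).hom ≫ (β_ X (A ⊗ B)).hom ⊗≫ A ◁ ((β_ B X).hom ≫ (β_ X B).hom) ⊗≫ e ▷ X =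
      𝟙 _ ⊗≫ ((β_ X B).hom ≫ (β_ B X).hom) ▷ A ⊗≫ X ◁ ((β_ B A).hom ≫ e) ⊗≫ 𝟙 _ := by
  calc _ = (X ◁ (β_ B A).hom ≫ (β_ X (A ⊗ B)).hom) ⊗≫ A ◁ ((β_ B X).hom ≫ (β_ X B).hom) ⊗≫
          e ▷ X := by monoidal
    _ = 𝟙 _ ⊗≫ (β_ X B).hom ▷ A ⊗≫ (𝟙 ((B ⊗ X) ⊗ A) ⊗≫ (B ◁ (β_ X A).hom ⊗≫ (β_ B A).hom ▷ X ⊗≫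
          A ◁ (β_ B X).hom) ⊗≫ 𝟙 ((A ⊗ X) ⊗ B)) ⊗≫ A ◁ (β_ X B).hom ⊗≫ e ▷ X := by
        rw [BraidedCategory.braiding_naturality_right, BraidedCategory.braiding_tensor_right_hom]
        monoidal
    _ = 𝟙 _ ⊗≫ ((β_ X B).hom ≫ (β_ B X).hom) ▷ A ⊗≫ X ◁ (β_ B A).hom ⊗≫ (X ◁ e) ⊗≫ 𝟙 _ := by
        rw [← BraidedCategory.yang_baxter', braiding_slide_right e X]; monoidal
    _ = _ := by monoidal

end Braiding

/-! ### The encircling action of the coend. -/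

section Encircle

variable {C : Type u} [Category.{v} C] [MonoidalCategory C] [RigidCategory C] [BraidedCategory C]

/-- The double braiding of `X` with `W`, closed up with the evaluation of `X`. -/
def encircleFamily (X W : C) : (Xᘁ ⊗ X) ⊗ W ⟶ W :=
  𝟙 _ ⊗≫ (Xᘁ : C) ◁ ((β_ X W).hom ≫ (β_ W X).hom) ⊗≫ ε_ X (Xᘁ : C) ▷ W ⊗≫ 𝟙 _

lemma encircleFamily_dinatural {X X' : C} (W : C) (g : X ⟶ X') :
    gᘁ ▷ X ▷ W ≫ encircleFamily X W = ((X'ᘁ : C) ◁ g) ▷ W ≫ encircleFamily X' W := by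
  unfold encircleFamily
  calc _ = 𝟙 _ ⊗≫ (gᘁ ▷ (X ⊗ W) ≫ (Xᘁ : C) ◁ ((β_ X W).hom ≫ (β_ W X).hom)) ⊗≫
          ε_ X (Xᘁ : C) ▷ W ⊗≫ 𝟙 _ := by monoidal
    _ = 𝟙 _ ⊗≫ (X'ᘁ : C) ◁ ((β_ X W).hom ≫ (β_ W X).hom) ⊗≫
          (gᘁ ▷ X ≫ ε_ X (Xᘁ : C)) ▷ W ⊗≫ 𝟙 _ := by rw [← whisker_exchange]; monoidal
    _ = 𝟙 _ ⊗≫ (X'ᘁ : C) ◁ ((β_ X W).hom ≫ (β_ W X).hom ≫ g ▷ W) ⊗≫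
          ε_ X' (X'ᘁ : C) ▷ W ⊗≫ 𝟙 _ := by rw [rightAdjointMate_comp_evaluation]; monoidal
    _ = _ := by
      rw [← BraidedCategory.braiding_naturality_right,
        ← BraidedCategory.braiding_naturality_left_assoc]
      monoidal

lemma encircleFamily_naturality (X : C) {W W' : C} (f : W ⟶ W') :
    (Xᘁ ⊗ X) ◁ f ≫ encircleFamily X W' = encircleFamily X W ≫ f := by
  unfold encircleFamily
  calc _ = 𝟙 _ ⊗≫ (Xᘁ : C) ◁ (X ◁ f ≫ (β_ X W').hom ≫ (β_ W' X).hom) ⊗≫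
          ε_ X (Xᘁ : C) ▷ W' ⊗≫ 𝟙 _ := by monoidal
    _ = 𝟙 _ ⊗≫ (Xᘁ : C) ◁ ((β_ X W).hom ≫ (β_ W X).hom) ⊗≫
          ((Xᘁ ⊗ X) ◁ f ≫ ε_ X (Xᘁ : C) ▷ W') ⊗≫ 𝟙 _ := by
      rw [BraidedCategory.braiding_naturality_right_assoc,
        BraidedCategory.braiding_naturality_left]
      monoidal
    _ = _ := by rw [whisker_exchange]; monoidal

lemma encircleFamily_unit (X : C) :
    encircleFamily X (𝟙_ C) = (ρ_ (Xᘁ ⊗ X)).hom ≫ ε_ X (Xᘁ : C) := by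
  unfold encircleFamily
  rw [braiding_tensorUnit_left, braiding_tensorUnit_right]
  monoidal

lemma hopfPairingFamily_eq_encircleFamily (X Y : C) :
    hopfPairingFamily X Y =
      (α_ _ _ _).inv ≫ encircleFamily X (Yᘁ : C) ▷ Y ≫ ε_ Y (Yᘁ : C) := by
  unfold hopfPairingFamily encircleFamily
  rw [MonoidalCategory.tensorHom_def]
  monoidal

/-- The product of the coend followed by a modified evaluation. -/
def mulEval (X Y : C) (f : Y ⊗ X ⟶ Y ⊗ X) : (Xᘁ ⊗ X) ⊗ (Yᘁ ⊗ Y) ⟶ 𝟙_ C :=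
  𝟙 _ ⊗≫ (Xᘁ : C) ◁ ((β_ X (Yᘁ ⊗ Y)).hom ⊗≫ (Yᘁ : C) ◁ f ⊗≫ ε_ Y (Yᘁ : C) ▷ X) ⊗≫
    ε_ X (Xᘁ : C)

lemma tensorHom_comp_mulEval {X Y : C} (a : X ⟶ X) (b : Y ⟶ Y) (f : Y ⊗ X ⟶ Y ⊗ X) :
    ((Xᘁ : C) ◁ a ⊗ₘ (Yᘁ : C) ◁ b) ≫ mulEval X Y f = mulEval X Y ((b ⊗ₘ a) ≫ f) := by
  unfold mulEval
  rw [MonoidalCategory.tensorHom_def, MonoidalCategory.tensorHom_def']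
  calc _ = 𝟙 _ ⊗≫ (Xᘁ : C) ◁ ((a ▷ (Yᘁ ⊗ Y) ≫ X ◁ ((Yᘁ : C) ◁ b) ≫ (β_ X (Yᘁ ⊗ Y)).hom) ⊗≫
          (Yᘁ : C) ◁ f ⊗≫ ε_ Y (Yᘁ : C) ▷ X) ⊗≫ ε_ X (Xᘁ : C) := by monoidal
    _ = _ := by
      rw [BraidedCategory.braiding_naturality_right,
        BraidedCategory.braiding_naturality_left_assoc]
      monoidal

lemma mulEval_monodromy_inv (X Y : C) :
    mulEval X Y ((β_ X Y).inv ≫ (β_ Y X).inv) = hopfPairingFamily X Y := by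
  unfold mulEval hopfPairingFamily
  rw [monodromy_slide, MonoidalCategory.tensorHom_def']
  monoidal

lemma mulEval_monodromy (X Y : C) :
    (Xᘁ ⊗ X) ◁ (β_ Y (Yᘁ : C)).hom ≫ mulEval X Y ((β_ Y X).hom ≫ (β_ X Y).hom) =
      (α_ _ _ _).inv ≫ encircleFamily X Y ▷ (Yᘁ : C) ≫ (β_ Y (Yᘁ : C)).hom ≫
        ε_ Y (Yᘁ : C) := by
  unfold mulEval encircleFamily
  calc _ = 𝟙 _ ⊗≫ (Xᘁ : C) ◁ (X ◁ (β_ Y (Yᘁ : C)).hom ≫ (β_ X (Yᘁ ⊗ Y)).hom ⊗≫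
          (Yᘁ : C) ◁ ((β_ Y X).hom ≫ (β_ X Y).hom) ⊗≫ ε_ Y (Yᘁ : C) ▷ X) ⊗≫ ε_ X (Xᘁ : C) := by
        monoidal
    _ = 𝟙 _ ⊗≫ (Xᘁ : C) ◁ ((β_ X Y).hom ≫ (β_ Y X).hom) ▷ (Yᘁ : C) ⊗≫
          ((Xᘁ ⊗ X) ◁ ((β_ Y (Yᘁ : C)).hom ≫ ε_ Y (Yᘁ : C)) ≫ ε_ X (Xᘁ : C) ▷ 𝟙_ C) ⊗≫ 𝟙 _ := by
        rw [monodromy_flip]; monoidal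
    _ = _ := by rw [whisker_exchange]; monoidal

variable [HasCoend (dualTensor C)]

lemma coendMulFamily_eval (X Y : C) (f : Y ⊗ X ⟶ Y ⊗ X) {h : coendObj C ⟶ 𝟙_ C}
    (hh : coendι (Y ⊗ X) ≫ h = ((Y ⊗ X)ᘁ : C) ◁ f ≫ ε_ (Y ⊗ X) ((Y ⊗ X)ᘁ : C)) :
    coendMulFamily X Y ≫ h = mulEval X Y f := by
  unfold coendMulFamily mulEval
  calc _ = 𝟙 _ ⊗≫ (Xᘁ : C) ◁ (β_ X (Yᘁ ⊗ Y)).hom ⊗≫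
        (rightDualTensorIso Y X).inv ▷ (Y ⊗ X) ≫ coendι (Y ⊗ X) ≫ h := by
        simp only [monoidalComp, Category.assoc]
    _ = 𝟙 _ ⊗≫ (Xᘁ : C) ◁ (β_ X (Yᘁ ⊗ Y)).hom ⊗≫ (Xᘁ ⊗ (Yᘁ : C)) ◁ f ≫
        ((rightDualTensorIso Y X).inv ▷ (Y ⊗ X) ≫ ε_ (Y ⊗ X) ((Y ⊗ X)ᘁ : C)) := by
        rw [hh, ← whisker_exchange_assoc]
    _ = _ := by
        rw [rightDualTensorIso_inv_eval, ExactPairing.tensor_evaluation]; monoidal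

/-- Tensoring with `W` has a right adjoint by rigidity, so the whiskered universal family is still
jointly epic. -/
lemma coend_whiskerRight_ext {W Z : C} {g h : coendObj C ⊗ W ⟶ Z}
    (w : ∀ X : C, coendι X ▷ W ≫ g = coendι X ▷ W ≫ h) : g = h := by
  apply (tensorRightHomEquiv _ W (Wᘁ : C) Z).injective
  apply coend_hom_ext
  intro X
  apply (tensorRightHomEquiv _ W (Wᘁ : C) Z).symm.injective
  simpa only [tensorRightHomEquiv_symm_naturality, Equiv.symm_apply_apply] using w X

lemma coend_whiskerLeft_ext {W Z : C} {g h : W ⊗ coendObj C ⟶ Z}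
    (w : ∀ X : C, W ◁ coendι X ≫ g = W ◁ coendι X ≫ h) : g = h := by
  apply (tensorLeftHomEquiv _ (ᘁW : C) W Z).injective
  apply coend_hom_ext
  intro X
  apply (tensorLeftHomEquiv _ (ᘁW : C) W Z).symm.injective
  simpa only [tensorLeftHomEquiv_symm_naturality, Equiv.symm_apply_apply] using w X

lemma coend_whiskerRight_ext₂ {W Z : C} {g h : (coendObj C ⊗ coendObj C) ⊗ W ⟶ Z}
    (w : ∀ X Y : C, (coendι X ⊗ₘ coendι Y) ▷ W ≫ g = (coendι X ⊗ₘ coendι Y) ▷ W ≫ h) :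
    g = h := by
  apply (tensorRightHomEquiv _ W (Wᘁ : C) Z).injective
  apply coend_hom_ext₂
  intro X Y
  apply (tensorRightHomEquiv _ W (Wᘁ : C) Z).symm.injective
  simpa only [tensorRightHomEquiv_symm_naturality, Equiv.symm_apply_apply] using w X Y

lemma encircle_dinatural {X X' : C} (W : C) (g : X ⟶ X') :
    gᘁ ▷ X ≫ tensorRightHomEquiv _ W (Wᘁ : C) W (encircleFamily X W) =
      (X'ᘁ : C) ◁ g ≫ tensorRightHomEquiv _ W (Wᘁ : C) W (encircleFamily X' W) := by
  apply (tensorRightHomEquiv _ W (Wᘁ : C) W).symm.injective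
  simpa only [tensorRightHomEquiv_symm_naturality, Equiv.symm_apply_apply] using
    encircleFamily_dinatural W g

/-- The action of the coend on an object `W`, by encircling `W`. -/
def encircle (W : C) : coendObj C ⊗ W ⟶ W :=
  (tensorRightHomEquiv _ W (Wᘁ : C) W).symm
    (coendDesc (fun X => tensorRightHomEquiv _ W (Wᘁ : C) W (encircleFamily X W))
      (fun g => encircle_dinatural W g))

lemma coendι_encircle (X W : C) : coendι X ▷ W ≫ encircle W = encircleFamily X W := by
  unfold encircle
  rw [← tensorRightHomEquiv_symm_naturality, coendι_desc _ (fun g => encircle_dinatural W g),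
    Equiv.symm_apply_apply]

lemma encircle_naturality {W W' : C} (f : W ⟶ W') :
    coendObj C ◁ f ≫ encircle W' = encircle W ≫ f := by
  apply coend_whiskerRight_ext
  intro X
  rw [← whisker_exchange_assoc, coendι_encircle, reassoc_of% coendι_encircle (C := C),
    encircleFamily_naturality]

lemma encircle_unit : encircle (𝟙_ C) = (ρ_ (coendObj C)).hom ≫ coendCounit := by
  apply coend_whiskerRight_ext
  intro X
  rw [coendι_encircle, encircleFamily_unit, rightUnitor_naturality_assoc, coendCounit,
    coendι_desc _ (fun g => rightAdjointMate_comp_evaluation g)]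

lemma whiskerLeft_coendι_hopfPairing (V : C) :
    coendObj C ◁ coendι V ≫ hopfPairing =
      (α_ _ _ _).inv ≫ encircle (Vᘁ : C) ▷ V ≫ ε_ V (Vᘁ : C) := by
  apply coend_whiskerRight_ext
  intro X
  have := coendι_desc₂ (C := C) hopfPairingFamily hopfPairingFamily_left hopfPairingFamily_right X V
  rw [MonoidalCategory.tensorHom_def, Category.assoc] at this
  unfold hopfPairing
  rw [this, hopfPairingFamily_eq_encircleFamily, ← coendι_encircle]
  simp

/-- The hexagon identities split a circle labelled `Y ⊗ X` into two nested circles, `Y` inside. The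
braiding in the product is absorbed by naturality, by sliding `X` past the whole circle of `Y`
around `W`. -/
lemma encircleFamily_mul (X Y W : C) :
    coendMulFamily X Y ▷ W ≫ encircle W = (α_ _ _ _).hom ≫
      ((Xᘁ : C) ⊗ X) ◁ encircleFamily Y W ≫ encircleFamily X W := by
  unfold coendMulFamily
  calc _ = 𝟙 _ ⊗≫ (Xᘁ : C) ◁ (β_ X (Yᘁ ⊗ Y)).hom ▷ W ⊗≫
        (rightDualTensorIso Y X).inv ▷ (Y ⊗ X) ▷ W ≫ coendι (Y ⊗ X) ▷ W ≫ encircle W := by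
        monoidal
    _ = 𝟙 _ ⊗≫ (Xᘁ : C) ◁ (β_ X (Yᘁ ⊗ Y)).hom ▷ W ⊗≫
        ((rightDualTensorIso Y X).inv ▷ ((Y ⊗ X) ⊗ W) ≫
          ((Y ⊗ X)ᘁ : C) ◁ ((β_ (Y ⊗ X) W).hom ≫ (β_ W (Y ⊗ X)).hom)) ⊗≫
            ε_ (Y ⊗ X) ((Y ⊗ X)ᘁ : C) ▷ W ⊗≫ 𝟙 _ := by
        rw [coendι_encircle, encircleFamily]; monoidal
    _ = 𝟙 _ ⊗≫ (Xᘁ : C) ◁ (β_ X (Yᘁ ⊗ Y)).hom ▷ W ⊗≫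
          (Xᘁ ⊗ (Yᘁ : C)) ◁ ((β_ (Y ⊗ X) W).hom ≫ (β_ W (Y ⊗ X)).hom) ⊗≫
          ((rightDualTensorIso Y X).inv ▷ (Y ⊗ X) ≫ ε_ (Y ⊗ X) ((Y ⊗ X)ᘁ : C)) ▷ W ⊗≫ 𝟙 _ := by
        rw [← whisker_exchange]; monoidal
    _ = 𝟙 _ ⊗≫ (Xᘁ : C) ◁ (β_ X (Yᘁ ⊗ Y)).hom ▷ W ⊗≫
          (Xᘁ : C) ◁ (Yᘁ ⊗ Y) ◁ (β_ X W).hom ⊗≫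
          (Xᘁ : C) ◁ (Yᘁ : C) ◁ ((β_ Y W).hom ≫ (β_ W Y).hom) ▷ X ⊗≫
          (Xᘁ : C) ◁ ((Yᘁ ⊗ Y) ◁ (β_ W X).hom ≫ ε_ Y (Yᘁ : C) ▷ (X ⊗ W)) ⊗≫
          ε_ X (Xᘁ : C) ▷ W ⊗≫ 𝟙 _ := by
        rw [rightDualTensorIso_inv_eval, ExactPairing.tensor_evaluation,
          BraidedCategory.braiding_tensor_left_hom, BraidedCategory.braiding_tensor_right_hom W]
        monoidal
    _ = 𝟙 _ ⊗≫ (Xᘁ : C) ◁ ((β_ X ((Yᘁ ⊗ Y) ⊗ W)).hom ≫ encircleFamily Y W ▷ X) ⊗≫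
          (Xᘁ : C) ◁ (β_ W X).hom ⊗≫ ε_ X (Xᘁ : C) ▷ W ⊗≫ 𝟙 _ := by
        rw [whisker_exchange, BraidedCategory.braiding_tensor_right_hom X (Yᘁ ⊗ Y) W,
          encircleFamily]
        monoidal
    _ = _ := by
        rw [← BraidedCategory.braiding_naturality_right]
        unfold encircleFamily
        monoidal

/-- Encircling turns the product of the coend into composition. -/
lemma encircle_mul (W : C) :
    coendMul ▷ W ≫ encircle W = (α_ _ _ _).hom ≫ coendObj C ◁ encircle W ≫ encircle W := by
  apply coend_whiskerRight_ext₂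
  intro X Y
  have := coendι_desc₂ (C := C) coendMulFamily coendMulFamily_left coendMulFamily_right X Y
  rw [← comp_whiskerRight_assoc, coendMul, this, encircleFamily_mul,
    MonoidalCategory.tensorHom_def, comp_whiskerRight_assoc, associator_naturality_middle_assoc,
    associator_naturality_left_assoc, ← MonoidalCategory.whiskerLeft_comp_assoc, coendι_encircle,
    ← whisker_exchange_assoc, coendι_encircle]

end Encircle

/-! ### Consequences of a non-degenerate Hopf pairing. -/

section Nondegenerate

variable {C : Type u} [Category.{v} C] [MonoidalCategory C] [RigidCategory C]

lemma pairingToDual_eq {L : C} (p : L ⊗ L ⟶ 𝟙_ C) :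
    pairingToDual p = tensorRightHomEquiv L L (Lᘁ : C) (𝟙_ C) p ≫ (λ_ (Lᘁ : C)).hom := by
  simp [pairingToDual, tensorRightHomEquiv]

lemma tensorRightHomEquiv_leftUnitor_eval {K L : C} (m : K ⊗ L ⟶ 𝟙_ C) :
    (tensorRightHomEquiv K L (Lᘁ : C) (𝟙_ C) m ≫ (λ_ (Lᘁ : C)).hom) ▷ L ≫ ε_ L (Lᘁ : C) = m := by
  apply (tensorRightHomEquiv K L (Lᘁ : C) (𝟙_ C)).injective
  rw [tensorRightHomEquiv_whiskerRight_comp_evaluation, Category.assoc, Iso.hom_inv_id,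
    Category.comp_id]

lemma pairingToDual_eval {L : C} (p : L ⊗ L ⟶ 𝟙_ C) :
    pairingToDual p ▷ L ≫ ε_ L (Lᘁ : C) = p := by
  rw [pairingToDual_eq, tensorRightHomEquiv_leftUnitor_eval]

lemma tensorLeftHomEquiv_whiskerLeft_eval {W X : C} (f : W ⟶ X) :
    tensorLeftHomEquiv W X (Xᘁ : C) (𝟙_ C) ((Xᘁ : C) ◁ f ≫ ε_ X (Xᘁ : C)) = f ≫ (ρ_ X).inv := by
  calc tensorLeftHomEquiv W X (Xᘁ : C) (𝟙_ C) ((Xᘁ : C) ◁ f ≫ ε_ X (Xᘁ : C))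
      = 𝟙 _ ⊗≫ (η_ X (Xᘁ : C) ▷ W ≫ (X ⊗ (Xᘁ : C)) ◁ f) ⊗≫ X ◁ ε_ X (Xᘁ : C) := by
        dsimp [tensorLeftHomEquiv]; monoidal
    _ = f ⊗≫ (η_ X (Xᘁ : C) ▷ X ⊗≫ X ◁ ε_ X (Xᘁ : C)) := by
        rw [← whisker_exchange]; monoidal
    _ = _ := by rw [evaluation_coevaluation'']; monoidal

lemma eval_ext_left {X W : C} {g h : W ⟶ X}
    (w : (Xᘁ : C) ◁ g ≫ ε_ X (Xᘁ : C) = (Xᘁ : C) ◁ h ≫ ε_ X (Xᘁ : C)) : g = h := by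
  have := congrArg (tensorLeftHomEquiv W X (Xᘁ : C) (𝟙_ C)) w
  rw [tensorLeftHomEquiv_whiskerLeft_eval, tensorLeftHomEquiv_whiskerLeft_eval] at this
  exact (cancel_mono _).1 this

/-- Dualizing is full: bend `g` around with the evaluation of `X` and the coevaluation of `Y`. -/
lemma exists_rightAdjointMate_eq {X Y : C} (g : (Yᘁ : C) ⟶ (Xᘁ : C)) : ∃ f : X ⟶ Y, fᘁ = g := by
  refine ⟨tensorLeftHomEquiv X Y (Yᘁ : C) (𝟙_ C) (g ▷ X ≫ ε_ X (Xᘁ : C)) ≫ (ρ_ Y).hom,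
    eval_ext ?_⟩
  rw [rightAdjointMate_comp_evaluation]
  apply (tensorLeftHomEquiv X Y (Yᘁ : C) (𝟙_ C)).injective
  rw [tensorLeftHomEquiv_whiskerLeft_eval, Category.assoc, Iso.hom_inv_id, Category.comp_id]

/-- The pairing only controls the action on objects of the form `Vᘁ`; this lets them stand for all
objects. -/
lemma exists_iso_rightDual (X : C) : ∃ V : C, Nonempty (X ≅ (Vᘁ : C)) :=
  ⟨(ᘁX : C), ⟨rightDualIso HasLeftDual.exact
    (RightRigidCategory.rightDual (ᘁX : C)).exact⟩⟩

variable [BraidedCategory C]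

lemma braided_eval_ext {X W : C} {g h : W ⟶ X}
    (w : g ▷ (Xᘁ : C) ≫ (β_ X (Xᘁ : C)).hom ≫ ε_ X (Xᘁ : C) =
      h ▷ (Xᘁ : C) ≫ (β_ X (Xᘁ : C)).hom ≫ ε_ X (Xᘁ : C)) : g = h := by
  rw [BraidedCategory.braiding_naturality_left_assoc,
    BraidedCategory.braiding_naturality_left_assoc] at w
  exact eval_ext_left ((cancel_epi _).1 w)

variable [HasCoend (dualTensor C)]

/-- The actions on all `Vᘁ` recover the Hopf pairing, hence the morphism into the coend. -/
lemma encircle_ext (hω : IsIso (pairingToDual (hopfPairing (C := C)))) {K : C}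
    {Λ Λ' : K ⟶ coendObj C}
    (h : ∀ V : C, Λ ▷ (Vᘁ : C) ≫ encircle (Vᘁ : C) = Λ' ▷ (Vᘁ : C) ≫ encircle (Vᘁ : C)) :
    Λ = Λ' := by
  rw [← cancel_mono (pairingToDual (hopfPairing (C := C)))]
  apply eval_ext
  rw [comp_whiskerRight_assoc, comp_whiskerRight_assoc, pairingToDual_eval]
  apply coend_whiskerLeft_ext
  intro V
  rw [whisker_exchange_assoc, whisker_exchange_assoc, whiskerLeft_coendι_hopfPairing,
    associator_inv_naturality_left_assoc, associator_inv_naturality_left_assoc,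
    ← comp_whiskerRight_assoc, ← comp_whiskerRight_assoc, h]

lemma hopfPairing_ext_left (hω : IsIso (pairingToDual (hopfPairing (C := C)))) {K : C}
    {Λ Λ' : K ⟶ coendObj C} (h : Λ ▷ coendObj C ≫ hopfPairing = Λ' ▷ coendObj C ≫ hopfPairing) :
    Λ = Λ' := by
  rw [← cancel_mono (pairingToDual (hopfPairing (C := C)))]
  apply eval_ext
  rwa [comp_whiskerRight_assoc, comp_whiskerRight_assoc, pairingToDual_eval]

/-- Invertibility of `L ⟶ Lᘁ` gives cancellation in the second variable too: the pairing is
evaluation after an isomorphism in the first tensor factor, which can be cancelled. -/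
lemma hopfPairing_ext_right (hω : IsIso (pairingToDual (hopfPairing (C := C)))) {K : C}
    {Λ Λ' : K ⟶ coendObj C} (h : coendObj C ◁ Λ ≫ hopfPairing = coendObj C ◁ Λ' ≫ hopfPairing) :
    Λ = Λ' := by
  apply eval_ext_left
  rw [← pairingToDual_eval (hopfPairing (C := C)), whisker_exchange_assoc,
    whisker_exchange_assoc] at h
  exact (cancel_epi _).1 h

/-- Every natural transformation `K ⊗ - ⟶ 𝟭` comes from a morphism to the coend, by encircling. -/
lemma exists_encircle_eq (hω : IsIso (pairingToDual (hopfPairing (C := C)))) {K : C}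
    (ψ : ∀ W : C, K ⊗ W ⟶ W) (hψ : ∀ {W W' : C} (f : W ⟶ W'), K ◁ f ≫ ψ W' = ψ W ≫ f) :
    ∃ Λ : K ⟶ coendObj C, ∀ V : C, Λ ▷ (Vᘁ : C) ≫ encircle (Vᘁ : C) = ψ (Vᘁ : C) := by
  -- The value that the pairing of `Λ` with `coendι V` must take if `Λ` acts on `Vᘁ` by `ψ`.
  -- Naturality of `ψ` is dinaturality of this family, so it descends to `m : K ⊗ L ⟶ 𝟙`, and
  -- inverting the pairing gives `Λ`.
  let h : ∀ V : C, K ⊗ (Vᘁ ⊗ V) ⟶ 𝟙_ C :=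
    fun V => (α_ _ _ _).inv ≫ ψ (Vᘁ : C) ▷ V ≫ ε_ V (Vᘁ : C)
  have hh : ∀ {V V' : C} (g : V ⟶ V'), K ◁ (gᘁ ▷ V) ≫ h V = K ◁ ((V'ᘁ : C) ◁ g) ≫ h V' := by
    intro V V' g
    simp only [h]
    rw [associator_inv_naturality_middle_assoc, ← comp_whiskerRight_assoc, hψ,
      comp_whiskerRight_assoc, rightAdjointMate_comp_evaluation,
      associator_inv_naturality_right_assoc, whisker_exchange_assoc]
  have hd : ∀ {V V' : C} (g : V ⟶ V'), gᘁ ▷ V ≫ tensorLeftHomEquiv _ (ᘁK : C) K (𝟙_ C) (h V) =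
      (V'ᘁ : C) ◁ g ≫ tensorLeftHomEquiv _ (ᘁK : C) K (𝟙_ C) (h V') := by
    intro V V' g
    apply (tensorLeftHomEquiv _ (ᘁK : C) K (𝟙_ C)).symm.injective
    simpa only [tensorLeftHomEquiv_symm_naturality, Equiv.symm_apply_apply] using hh g
  let m : K ⊗ coendObj C ⟶ 𝟙_ C :=
    (tensorLeftHomEquiv _ (ᘁK : C) K (𝟙_ C)).symm (coendDesc _ hd)
  have hm : ∀ V, K ◁ coendι V ≫ m = h V := by
    intro V
    simp only [m]
    rw [← tensorLeftHomEquiv_symm_naturality, coendι_desc _ hd, Equiv.symm_apply_apply]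
  refine ⟨(tensorRightHomEquiv K (coendObj C) _ (𝟙_ C) m ≫ (λ_ _).hom) ≫
    inv (pairingToDual (hopfPairing (C := C))), fun V => ?_⟩
  set Λ := (tensorRightHomEquiv K (coendObj C) _ (𝟙_ C) m ≫ (λ_ _).hom) ≫
    inv (pairingToDual (hopfPairing (C := C))) with hΛ
  have hω' : Λ ▷ coendObj C ≫ hopfPairing = m := by
    rw [← pairingToDual_eval (hopfPairing (C := C)), ← comp_whiskerRight_assoc, hΛ, Category.assoc,
      IsIso.inv_hom_id, Category.comp_id, tensorRightHomEquiv_leftUnitor_eval]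
  apply eval_ext
  have := hm V
  rw [← hω', whisker_exchange_assoc, whiskerLeft_coendι_hopfPairing,
    associator_inv_naturality_left_assoc, ← comp_whiskerRight_assoc] at this
  exact (cancel_epi _).1 this

end Nondegenerate

/-! ### Twisted pairings and non-vanishing on integrals. -/

section Twist

variable {C : Type u} [Category.{v} C] [MonoidalCategory C] [RigidCategory C] [BraidedCategory C]
  [RibbonCategory C]

lemma twist_tensorHom_comp_inv (X Y : C) :
    ((RibbonCategory.twist X).hom ⊗ₘ (RibbonCategory.twist Y).hom) ≫
      (RibbonCategory.twist (X ⊗ Y)).inv = (β_ Y X).inv ≫ (β_ X Y).inv := by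
  rw [← cancel_mono (RibbonCategory.twist (X ⊗ Y)).hom, Category.assoc, Iso.inv_hom_id,
    Category.comp_id, RibbonCategory.twist_naturality, RibbonCategory.twist_tensor]
  simp [Category.assoc]

lemma twistInv_tensorHom_comp (X Y : C) :
    ((RibbonCategory.twist X).inv ⊗ₘ (RibbonCategory.twist Y).inv) ≫
      (RibbonCategory.twist (X ⊗ Y)).hom = (β_ X Y).hom ≫ (β_ Y X).hom := by
  rw [RibbonCategory.twist_tensor, tensorHom_comp_tensorHom_assoc, Iso.inv_hom_id, Iso.inv_hom_id,
    tensorHom_id, id_whiskerRight, Category.id_comp]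

variable [HasCoend (dualTensor C)]

lemma coendι_twist_hom (X : C) : coendι X ≫ coendTwist.hom =
    (Xᘁ : C) ◁ (RibbonCategory.twist X).hom ≫ coendι X :=
  coendι_desc _ coendTwist_dinatural X

lemma coendι_twist_inv (X : C) : coendι X ≫ coendTwist.inv =
    (Xᘁ : C) ◁ (RibbonCategory.twist X).inv ≫ coendι X :=
  coendι_desc _ coendTwistInv_dinatural X

lemma coendι_counit (X : C) : coendι X ≫ coendCounit = ε_ X (Xᘁ : C) :=
  coendι_desc _ (fun g => rightAdjointMate_comp_evaluation g) X

lemma coendι_mul (X Y : C) : (coendι X ⊗ₘ coendι Y) ≫ coendMul = coendMulFamily X Y :=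
  coendι_desc₂ coendMulFamily coendMulFamily_left coendMulFamily_right X Y

/-- The pairing `ε ∘ T⁻¹ ∘ μ` is the Hopf pairing up to the twist. -/
lemma twist_tensor_mul_twist_inv : (coendTwist.hom ⊗ₘ coendTwist.hom) ≫ coendMul (C := C) ≫
    coendTwist.inv ≫ coendCounit = hopfPairing := by
  apply coend_hom_ext₂
  intro X Y
  rw [tensorHom_comp_tensorHom_assoc, coendι_twist_hom, coendι_twist_hom,
    ← tensorHom_comp_tensorHom_assoc, reassoc_of% coendι_mul (C := C),
    coendMulFamily_eval X Y (RibbonCategory.twist (Y ⊗ X)).inv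
      (by rw [reassoc_of% coendι_twist_inv (C := C), coendι_counit]),
    tensorHom_comp_mulEval, twist_tensorHom_comp_inv, mulEval_monodromy_inv]
  exact (coendι_desc₂ hopfPairingFamily hopfPairingFamily_left hopfPairingFamily_right X Y).symm

/-- The pairing `ε ∘ T ∘ μ` is expressed by encircling, up to twists and a braiding. -/
lemma twistInv_tensor_mul_twist (Y : C) :
    coendObj C ◁ ((β_ Y (Yᘁ : C)).hom ≫ coendι Y) ≫ (coendTwist.inv ⊗ₘ coendTwist.inv) ≫
      coendMul ≫ coendTwist.hom ≫ coendCounit =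
    (α_ _ _ _).inv ≫ encircle Y ▷ (Yᘁ : C) ≫ (β_ Y (Yᘁ : C)).hom ≫ ε_ Y (Yᘁ : C) := by
  apply coend_whiskerRight_ext
  intro X
  rw [MonoidalCategory.whiskerLeft_comp_assoc, ← whisker_exchange_assoc,
    ← MonoidalCategory.tensorHom_def_assoc,
    tensorHom_comp_tensorHom_assoc, coendι_twist_inv, coendι_twist_inv,
    ← tensorHom_comp_tensorHom_assoc, reassoc_of% coendι_mul (C := C),
    coendMulFamily_eval X Y (RibbonCategory.twist (Y ⊗ X)).hom
      (by rw [reassoc_of% coendι_twist_hom (C := C), coendι_counit]),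
    tensorHom_comp_mulEval, twistInv_tensorHom_comp, mulEval_monodromy,
    associator_inv_naturality_left_assoc, ← comp_whiskerRight_assoc, coendι_encircle]

/-- A morphism `Λ : K ⟶ L` to the coend such that `μ ∘ (Λ ⊗ id) = Λ ⊗ ε`. -/
def IsRightIntegralFrom {K : C} (Λ : K ⟶ coendObj C) : Prop :=
  Λ ▷ coendObj C ≫ coendMul = K ◁ coendCounit ≫ (ρ_ K).hom ≫ Λ

lemma IsRightIntegralFrom.isRightIntegral {Λ : 𝟙_ C ⟶ coendObj C} (h : IsRightIntegralFrom Λ) :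
    IsRightIntegral Λ := by
  rw [IsRightIntegral, h, ← unitors_equal, leftUnitor_naturality_assoc]

lemma IsRightIntegral.isRightIntegralFrom {Λ : 𝟙_ C ⟶ coendObj C} (h : IsRightIntegral Λ) :
    IsRightIntegralFrom Λ := by
  rw [IsRightIntegralFrom, h, ← unitors_equal, leftUnitor_naturality_assoc]

variable [Preadditive C] [MonoidalPreadditive C]

/-- The Hopf pairing of `T⁻¹ ∘ Λ` with `x` is `ε ∘ T⁻¹ ∘ μ` at `Λ` and `T x`; the integral property
makes `ε ∘ T⁻¹ ∘ Λ` a factor of it. -/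
lemma IsRightIntegralFrom.eq_zero_of_twist_inv
    (hω : IsIso (pairingToDual (hopfPairing (C := C)))) {K : C} {Λ : K ⟶ coendObj C}
    (h : IsRightIntegralFrom Λ) (h0 : Λ ≫ coendTwist.inv ≫ coendCounit = 0) : Λ = 0 := by
  rw [← cancel_mono coendTwist.inv, zero_comp]
  apply hopfPairing_ext_left hω
  rw [MonoidalPreadditive.zero_whiskerRight, zero_comp, ← twist_tensor_mul_twist_inv,
    MonoidalCategory.tensorHom_def, Category.assoc, ← comp_whiskerRight_assoc, Category.assoc,
    Iso.inv_hom_id, Category.comp_id, ← whisker_exchange_assoc, reassoc_of% h, h0]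
  simp

lemma IsLeftIntegral.eq_zero_of_twist_inv
    (hω : IsIso (pairingToDual (hopfPairing (C := C)))) {Λ : 𝟙_ C ⟶ coendObj C}
    (h : IsLeftIntegral Λ) (h0 : Λ ≫ coendTwist.inv ≫ coendCounit = 0) : Λ = 0 := by
  rw [← cancel_mono coendTwist.inv, zero_comp]
  apply hopfPairing_ext_right hω
  rw [MonoidalPreadditive.whiskerLeft_zero, zero_comp, ← twist_tensor_mul_twist_inv,
    MonoidalCategory.tensorHom_def', Category.assoc, ← MonoidalCategory.whiskerLeft_comp_assoc,
    Category.assoc,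
    Iso.inv_hom_id, Category.comp_id, whisker_exchange_assoc, reassoc_of% h, h0]
  simp

lemma IsRightIntegralFrom.eq_zero_of_twist_hom
    (hω : IsIso (pairingToDual (hopfPairing (C := C)))) {K : C} {Λ : K ⟶ coendObj C}
    (h : IsRightIntegralFrom Λ) (h0 : Λ ≫ coendTwist.hom ≫ coendCounit = 0) : Λ = 0 := by
  -- The action of `T ∘ Λ` on `Y`, closed up by the braided evaluation, is `ε ∘ T ∘ μ` at `Λ` and
  -- another argument, so it has the vanishing factor `ε ∘ T ∘ Λ`. The braided evaluation is
  -- non-degenerate, so the action itself vanishes.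
  have key : ∀ Y : C, (α_ _ _ _).inv ≫
      ((Λ ≫ coendTwist.hom) ▷ Y ≫ encircle Y) ▷ (Yᘁ : C) ≫
      (β_ Y (Yᘁ : C)).hom ≫ ε_ Y (Yᘁ : C) = 0 := by
    intro Y
    rw [comp_whiskerRight_assoc, ← associator_inv_naturality_left_assoc,
      ← twistInv_tensor_mul_twist, ← whisker_exchange_assoc, MonoidalCategory.tensorHom_def,
      Category.assoc, ← comp_whiskerRight_assoc, Category.assoc, Iso.hom_inv_id, Category.comp_id,
      ← whisker_exchange_assoc, reassoc_of% h, h0]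
    simp
  rw [← cancel_mono coendTwist.hom, zero_comp]
  apply encircle_ext hω
  intro V
  apply braided_eval_ext
  rw [MonoidalPreadditive.zero_whiskerRight, zero_comp, MonoidalPreadditive.zero_whiskerRight,
    zero_comp]
  exact (cancel_epi (α_ _ _ _).inv).1 ((key _).trans comp_zero.symm)

end Twist

/-! ### Finite-dimensionality and projective covers. -/

/-- Fitting's lemma: some power of an element of a finite-dimensional algebra divides an
idempotent that acts as the identity on that power. -/
lemma exists_isIdempotentElem_fitting (k : Type*) [Field k] {R : Type*} [Ring R] [Algebra k R]
    [Module.Finite k R] (e : R) :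
    ∃ (n : ℕ) (x : R), IsIdempotentElem (x * e ^ (n + 1)) ∧
      e ^ (n + 1) * (x * e ^ (n + 1)) = e ^ (n + 1) ∧ x * e = e * x := by
  have hint : IsIntegral k e := Algebra.IsIntegral.isIntegral e
  have hp0 : minpoly k e ≠ 0 := minpoly.ne_zero hint
  -- The minimal polynomial is `X ^ n * q` with `X` not dividing `q`. A Bézout relation `a * X ^ (n
  -- + 1) + b * q = 1` makes `a * X ^ (n + 1)` evaluate to the idempotent. The exponent `n + 1` is
  -- positive even if `n = 0`, so that a factor `e` can be split off later.
  obtain ⟨q, hq, hdvd⟩ := (FiniteMultiplicity.of_prime_left Polynomial.prime_X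
    hp0).exists_eq_pow_mul_and_not_dvd
  set n := multiplicity (Polynomial.X : Polynomial k) (minpoly k e)
  have hcop : IsCoprime ((Polynomial.X : Polynomial k) ^ (n + 1)) q :=
    IsCoprime.pow_left ((Polynomial.irreducible_X.coprime_iff_not_dvd).2 hdvd)
  obtain ⟨a, b, hab⟩ := hcop
  have h0 : Polynomial.aeval e ((Polynomial.X : Polynomial k) ^ (n + 1) * q) = 0 := by
    rw [pow_succ', mul_assoc, ← hq, map_mul, minpoly.aeval, mul_zero]
  have h1 : (Polynomial.X : Polynomial k) ^ (n + 1) * (a * Polynomial.X ^ (n + 1)) =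
      Polynomial.X ^ (n + 1) - b * (Polynomial.X ^ (n + 1) * q) := by
    linear_combination (Polynomial.X : Polynomial k) ^ (n + 1) * hab
  have h2 : e ^ (n + 1) * (Polynomial.aeval e a * e ^ (n + 1)) = e ^ (n + 1) := by
    have := congrArg (Polynomial.aeval e) h1
    rw [map_sub, map_mul _ b, h0, mul_zero, sub_zero] at this
    simpa using this
  refine ⟨n, Polynomial.aeval e a, ?_, h2, ?_⟩
  · change _ * _ = _
    rw [mul_assoc, h2]
  · have := congrArg (Polynomial.aeval e) (mul_comm a Polynomial.X)
    simpa using this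

section Finite

variable {k : Type w} [Field k] {C : Type u} [Category.{v} C] [Abelian C] [Linear k C] {G : C}

lemma IsFiniteGenerator.finite_hom (hG : IsFiniteGenerator k G) (X Y : C) :
    Module.Finite k (X ⟶ Y) := by
  have hGG : Module.Finite k (G ⟶ G) := by
    obtain ⟨r, a, ha⟩ := hG.span
    refine Module.Finite.of_surjective (Fintype.linearCombination k a) fun f => ?_
    obtain ⟨c, hc⟩ := ha f
    exact ⟨c, by rw [Fintype.linearCombination_apply, hc]⟩
  have hGY : Module.Finite k (G ⟶ Y) := by
    obtain ⟨n, W, π, ι, p, _, hW⟩ := hG.cover Y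
    have := hG.projective
    let L : (Fin n → (G ⟶ G)) →ₗ[k] (G ⟶ Y) :=
      ∑ j, (Linear.rightComp k G (ι j ≫ p)).comp (LinearMap.proj j)
    refine Module.Finite.of_surjective L fun f => ⟨fun j => Projective.factorThru f p ≫ π j, ?_⟩
    calc L _ = ∑ j, (Projective.factorThru f p ≫ π j) ≫ ι j ≫ p := by
          simp [L, LinearMap.sum_apply]
      _ = Projective.factorThru f p ≫ (∑ j, π j ≫ ι j) ≫ p := by
          rw [Preadditive.sum_comp, Preadditive.comp_sum]
          simp only [Category.assoc]
      _ = f := by rw [hW, Category.id_comp, Projective.factorThru_comp]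
  obtain ⟨n, W, π, ι, p, _, hW⟩ := hG.cover X
  let L : (X ⟶ Y) →ₗ[k] (Fin n → (G ⟶ Y)) :=
    LinearMap.pi fun j => Linear.leftComp k Y (ι j ≫ p)
  refine Module.Finite.of_injective L fun f g hfg => ?_
  rw [← cancel_epi p]
  have h1 : ∀ j, ι j ≫ p ≫ f = ι j ≫ p ≫ g := fun j => by
    simpa [L] using congrFun hfg j
  calc p ≫ f = (∑ j, π j ≫ ι j) ≫ p ≫ f := by rw [hW, Category.id_comp]
    _ = (∑ j, π j ≫ ι j) ≫ p ≫ g := by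
      simp only [Preadditive.sum_comp, Category.assoc, h1]
    _ = p ≫ g := by rw [hW, Category.id_comp]

/-- The dimension of `G ⟶ X` serves as a length: if composing with `f` were onto, every map from `G`
to the cokernel of `f` would vanish, because `G` is projective and separating. -/
lemma IsFiniteGenerator.finrank_lt (hG : IsFiniteGenerator k G) {X Y : C} (f : X ⟶ Y) [Mono f]
    (hf : ¬ IsIso f) : Module.finrank k (G ⟶ X) < Module.finrank k (G ⟶ Y) := by
  have := hG.finite_hom G Y
  have := hG.projective
  have hinj : Function.Injective (Linear.rightComp k G f) := fun a b hab => by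
    simpa [cancel_mono] using hab
  rw [← LinearMap.finrank_range_of_inj hinj]
  refine Submodule.finrank_lt ?_
  intro htop
  apply hf
  have : Epi f := by
    apply Preadditive.epi_of_cokernel_zero
    apply hG.separating
    intro h
    obtain ⟨a, rfl⟩ : h ∈ LinearMap.range (Linear.rightComp k G f) := htop ▸ Submodule.mem_top
    simp
  exact isIso_of_mono_of_epi f

lemma IsFiniteGenerator.isIso_of_mono (hG : IsFiniteGenerator k G) {X : C} (f : X ⟶ X) [Mono f] :
    IsIso f := by
  by_contra h
  exact lt_irrefl _ (hG.finrank_lt f h)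

lemma IsFiniteGenerator.isIso_of_epi (hG : IsFiniteGenerator k G) {P : C} [Projective P]
    (f : P ⟶ P) [Epi f] : IsIso f := by
  have h : Projective.factorThru (𝟙 P) f ≫ f = 𝟙 P := Projective.factorThru_comp _ _
  have : Mono (Projective.factorThru (𝟙 P) f) := mono_of_mono_fac h
  have := hG.isIso_of_mono (Projective.factorThru (𝟙 P) f)
  exact IsIso.of_isIso_fac_left h

lemma IsFiniteGenerator.exists_simple (hG : IsFiniteGenerator k G) {X : C} (hX : ¬ IsZero X) :
    ∃ (S : C) (ι : S ⟶ X), Simple S ∧ Mono ι := by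
  induction hn : Module.finrank k (G ⟶ X) using Nat.strong_induction_on generalizing X with
  | _ n ih =>
    by_cases hS : Simple X
    · exact ⟨X, 𝟙 X, hS, inferInstance⟩
    · have : ∃ (Y : C) (f : Y ⟶ X), Mono f ∧ f ≠ 0 ∧ ¬ IsIso f := by
        by_contra hcon
        push Not at hcon
        refine hS ⟨fun {Y} f _ => ⟨fun _ h0 => hX ?_, fun hf => hcon Y f inferInstance hf⟩⟩
        subst h0
        exact IsZero.of_epi_zero Y X 
      obtain ⟨Y, f, _, hf0, hfi⟩ := this
      obtain ⟨S, ι, hS, _⟩ := ih _ (hn ▸ hG.finrank_lt f hfi)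
        (fun hY => hf0 (hY.eq_of_src _ _)) rfl
      exact ⟨S, ι ≫ f, hS, mono_comp _ _⟩

lemma projective_of_retract {X Y : C} [Projective X] (i : Y ⟶ X) (r : X ⟶ Y) (h : i ≫ r = 𝟙 Y) :
    Projective Y :=
  ⟨fun f e _ => ⟨i ≫ Projective.factorThru (r ≫ f) e, by
    rw [Category.assoc, Projective.factorThru_comp, ← Category.assoc, h, Category.id_comp]⟩⟩

lemma IsFiniteGenerator.exists_projective (hG : IsFiniteGenerator k G) (X : C) :
    ∃ (P : C) (p : P ⟶ X), Projective P ∧ Epi p := by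
  obtain ⟨n, W, π, ι, p, hp, hW⟩ := hG.cover X
  have := hG.projective
  refine ⟨W, p, ⟨fun f e _ => ⟨∑ j, π j ≫ Projective.factorThru (ι j ≫ f) e, ?_⟩⟩, hp⟩
  simp only [Preadditive.sum_comp, Category.assoc, Projective.factorThru_comp]
  simp only [← Category.assoc]
  rw [← Preadditive.sum_comp, hW, Category.id_comp]

/-- Simple objects have projective covers. -/
lemma IsFiniteGenerator.exists_projectiveCover (hG : IsFiniteGenerator k G) (S : C) [Simple S] :
    ∃ (P : C) (π : P ⟶ S), IsProjectiveCover π := by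
  classical
  let Q : ℕ → Prop := fun n => ∃ (P : C) (π : P ⟶ S), Projective P ∧ π ≠ 0 ∧
    Module.finrank k (G ⟶ P) = n
  have hQ : ∃ n, Q n := by
    obtain ⟨P, p, hP, hp⟩ := hG.exists_projective S
    refine ⟨_, P, p, hP, fun h0 => Simple.not_isZero S ?_, rfl⟩
    subst h0
    exact IsZero.of_epi_zero P S
  -- The cover is a projective object of least dimension with a non-zero map to `S`.
  obtain ⟨P, π, hP, hπ, hn⟩ := Nat.find_spec hQ
  have hmin : ∀ {P' : C} (π' : P' ⟶ S), Projective P' → π' ≠ 0 →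
      Module.finrank k (G ⟶ P) ≤ Module.finrank k (G ⟶ P') := fun π' hP' h' => by
    rw [hn]; exact Nat.find_min' hQ ⟨_, π', hP', h', rfl⟩
  refine ⟨P, π, hP, epi_of_nonzero_to_simple hπ, fun {R} g hg => ?_⟩
  set e : P ⟶ P := Projective.factorThru π (g ≫ π) ≫ g with he
  have heπ : e ≫ π = π := by
    rw [he, Category.assoc, Projective.factorThru_comp]
  have : Module.Finite k (End P) := hG.finite_hom P P
  -- The Fitting idempotent of `e` still satisfies `f ≫ π = π`, so its image is projective with a
  -- non-zero map to `S`. Minimality forces `f = 𝟙 P`.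
  obtain ⟨n, x, hf, hfe, hxe⟩ := exists_isIdempotentElem_fitting k (End.of e)
  set f : P ⟶ P := x * End.of e ^ (n + 1) with hfdef
  have hpow : ∀ m : ℕ, (show P ⟶ P from End.of e ^ m) ≫ π = π := by
    intro m
    induction m with
    | zero => exact Category.id_comp _
    | succ m ih =>
      rw [pow_succ, End.mul_def, Category.assoc, ih, heπ]
  have hfπ : f ≫ π = π := by
    have h1 : f ≫ (show P ⟶ P from End.of e ^ (n + 1)) = End.of e ^ (n + 1) := hfe
    calc f ≫ π = f ≫ (show P ⟶ P from End.of e ^ (n + 1)) ≫ π := by rw [hpow]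
      _ = π := by rw [← Category.assoc, h1]; exact hpow _
  have hff : f ≫ f = f := hf
  obtain ⟨Y, i, r, hir, hri⟩ := IsIdempotentComplete.idempotents_split P f hff
  have hY : Projective Y := projective_of_retract i r hir
  have hiπ : i ≫ π ≠ 0 := by
    intro h0
    apply hπ
    rw [← hfπ, ← hri, Category.assoc, h0, comp_zero]
  have : Mono i := mono_of_mono_fac hir
  have hi : IsIso i := by
    by_contra hcon
    exact absurd (hmin (i ≫ π) hY hiπ) (not_le.2 (hG.finrank_lt i hcon))
  have hr : r = inv i := by rw [← cancel_epi i, hir, IsIso.hom_inv_id]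
  have hf1 : f = 𝟙 P := by rw [← hri, hr, IsIso.inv_hom_id]
  -- Multiplication in `End` reverses composition: a factor `e` on the left is applied last, so `f =
  -- 𝟙 P` exhibits `e` as a split epimorphism.
  have hcomm : x * End.of e ^ (n + 1) = End.of e * (x * End.of e ^ n) := by
    rw [pow_succ', ← mul_assoc, hxe, mul_assoc]
  have hsplit : (show P ⟶ P from x * End.of e ^ n) ≫ e = 𝟙 P := by
    rw [← hf1, hfdef, hcomm]; rfl
  have : Epi e := epi_of_epi_fac hsplit
  exact epi_of_epi_fac he.symm

/-- Take `c` in the spectrum of `e`. If `c - e` did not vanish after `π`, it would be epi by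
essentiality, hence invertible. -/
lemma IsProjectiveCover.exists_scalar [IsAlgClosed k] (hG : IsFiniteGenerator k G) {P S : C}
    [Simple S] {π : P ⟶ S} (hπ : IsProjectiveCover π) (e : P ⟶ P) : ∃ c : k, e ≫ π = c • π := by
  have := hπ.projective
  have := hπ.epi
  have : Module.Finite k (End P) := hG.finite_hom P P
  have : Nontrivial (End P) := by
    refine nontrivial_of_ne (𝟙 P) 0 fun h => Simple.not_isZero S ?_
    have : π = 0 := by rw [← Category.id_comp π, h, zero_comp]
    subst this
    exact IsZero.of_epi_zero P S
  obtain ⟨c, hc⟩ := spectrum.nonempty_of_isAlgClosed_of_finiteDimensional k (End.of e)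
  refine ⟨c, ?_⟩
  rw [spectrum.mem_iff, isUnit_iff_isIso, Algebra.algebraMap_eq_smul_one] at hc
  by_contra hne
  apply hc
  have h1 : (show P ⟶ P from c • (1 : End P) - End.of e) ≫ π ≠ 0 := by
    intro h0
    apply hne
    change (c • 𝟙 P - e) ≫ π = 0 at h0
    rw [Preadditive.sub_comp, Linear.smul_comp, Category.id_comp, sub_eq_zero] at h0
    exact h0.symm
  have := epi_of_nonzero_to_simple h1
  have := hπ.essential _ this
  exact hG.isIso_of_epi (show P ⟶ P from c • (1 : End P) - End.of e)

lemma IsProjectiveCover.isIso_of_ne_zero (hG : IsFiniteGenerator k G) {P S : C}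
    [Simple S] {π : P ⟶ S} (hπ : IsProjectiveCover π) (e : P ⟶ P) (he : e ≫ π ≠ 0) : IsIso e := by
  have := hπ.projective
  have := hπ.essential e (epi_of_nonzero_to_simple he)
  exact hG.isIso_of_epi e

lemma IsProjectiveCover.ne_zero {P S : C} [Simple S] {π : P ⟶ S} (hπ : IsProjectiveCover π) :
    π ≠ 0 := by
  intro h
  have := hπ.epi
  subst h
  exact Simple.not_isZero S (IsZero.of_epi_zero P S)

/-- The simple subobject of an injective projective cover is contained in all its nonzero
subobjects. -/
lemma IsProjectiveCover.mono_of_comp_ne_zero [IsAlgClosed k] (hG : IsFiniteGenerator k G)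
    {P S : C} [Simple S] {π : P ⟶ S} (hπ : IsProjectiveCover π) [Injective P] {D X : C} [Simple D]
    (ι : D ⟶ P) (hι : ι ≠ 0) (a : P ⟶ X) (ha : ι ≫ a ≠ 0) : Mono a := by
  have : Mono (ι ≫ a) := mono_of_nonzero_from_simple ha
  -- `D` meets `kernel a` trivially, so by injectivity the projection of their sum onto `D` extends
  -- to an endomorphism `e` of `P`.
  have hmono : Mono (biprod.desc ι (kernel.ι a)) := by
    apply Preadditive.mono_of_cancel_zero
    intro T g hg
    have h1 : (g ≫ biprod.fst) ≫ ι ≫ a = 0 := by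
      have := hg =≫ a
      rw [biprod.desc_eq] at this
      simpa using this
    have h2 : g ≫ biprod.fst = 0 := by
      rw [← cancel_mono (ι ≫ a), h1, zero_comp]
    have h3 : g ≫ biprod.snd = 0 := by
      rw [← cancel_mono (kernel.ι a), zero_comp]
      rw [biprod.desc_eq, Preadditive.comp_add, ← Category.assoc, h2, zero_comp, zero_add] at hg
      simpa using hg
    apply biprod.hom_ext <;> simp [h2, h3]
  obtain ⟨e, he⟩ := Injective.factors (biprod.desc ι (0 : kernel a ⟶ P))
    (biprod.desc ι (kernel.ι a))
  have he1 : ι ≫ e = ι := by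
    have := biprod.inl ≫= he
    simpa using this
  have he2 : kernel.ι a ≫ e = 0 := by
    have := biprod.inr ≫= he
    simpa using this
  obtain ⟨c, hc⟩ := hπ.exists_scalar hG e
  -- `𝟙 P - e` kills `D`, so it is not invertible and must vanish after `π`. Hence `e` is
  -- invertible, although it kills `kernel a`.
  have hne : (𝟙 P - e) ≫ π = 0 := by
    by_contra hne
    have := hπ.isIso_of_ne_zero hG _ hne
    apply hι
    rw [← cancel_mono (𝟙 P - e), Preadditive.comp_sub, he1, Category.comp_id, sub_self, zero_comp]
  rw [Preadditive.sub_comp, Category.id_comp, sub_eq_zero] at hne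
  have := hπ.isIso_of_ne_zero hG e (hne ▸ hπ.ne_zero)
  apply Preadditive.mono_of_kernel_zero
  rw [← cancel_mono e, he2, zero_comp]

end Finite

/-! ### Exactness and projectivity under tensoring and duals. -/

section RigidExact

variable {C : Type u} [Category.{v} C] [MonoidalCategory C] [RigidCategory C]

lemma epi_whiskerRight {A B : C} (f : A ⟶ B) [Epi f] (X : C) : Epi (f ▷ X) := ⟨fun g h w => by
  apply (tensorRightHomEquiv _ X (Xᘁ : C) _).injective
  rw [← cancel_epi f]
  apply (tensorRightHomEquiv _ X (Xᘁ : C) _).symm.injective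
  simpa only [tensorRightHomEquiv_symm_naturality, Equiv.symm_apply_apply] using w⟩

lemma epi_whiskerLeft {A B : C} (f : A ⟶ B) [Epi f] (X : C) : Epi (X ◁ f) := ⟨fun g h w => by
  apply (tensorLeftHomEquiv _ (ᘁX : C) X _).injective
  rw [← cancel_epi f]
  apply (tensorLeftHomEquiv _ (ᘁX : C) X _).symm.injective
  simpa only [tensorLeftHomEquiv_symm_naturality, Equiv.symm_apply_apply] using w⟩

lemma mono_whiskerRight {A B : C} (f : A ⟶ B) [Mono f] (X : C) : Mono (f ▷ X) := ⟨fun g h w => by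
  apply (tensorRightHomEquiv _ (ᘁX : C) X _).symm.injective
  rw [← cancel_mono f]
  apply (tensorRightHomEquiv _ (ᘁX : C) X _).injective
  simpa only [tensorRightHomEquiv_naturality, Equiv.apply_symm_apply] using w⟩

lemma projective_tensor_right (Q : C) [Projective Q] (X : C) : Projective (Q ⊗ X) where
  factors {E Z} f e _ := by
    have := epi_whiskerRight e (Xᘁ : C)
    obtain ⟨g, hg⟩ := Projective.factors (tensorRightHomEquiv _ X (Xᘁ : C) _ f) (e ▷ (Xᘁ : C))
    refine ⟨(tensorRightHomEquiv _ X (Xᘁ : C) _).symm g, ?_⟩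
    apply (tensorRightHomEquiv _ X (Xᘁ : C) _).injective
    rw [tensorRightHomEquiv_naturality, Equiv.apply_symm_apply, hg]

lemma projective_tensor_left (Q : C) [Projective Q] (X : C) : Projective (X ⊗ Q) where
  factors {E Z} f e _ := by
    have := epi_whiskerLeft e (ᘁX : C)
    obtain ⟨g, hg⟩ := Projective.factors (tensorLeftHomEquiv _ (ᘁX : C) X _ f) ((ᘁX : C) ◁ e)
    refine ⟨(tensorLeftHomEquiv _ (ᘁX : C) X _).symm g, ?_⟩
    apply (tensorLeftHomEquiv _ (ᘁX : C) X _).injective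
    rw [tensorLeftHomEquiv_naturality, Equiv.apply_symm_apply, hg]

/-- Morphisms `Pᘁ ⟶ Z` are morphisms `𝟙 ⟶ P ⊗ Z`, and `P ◁ e` splits because `P ⊗ Z` is projective.
-/
lemma projective_rightDual (P : C) [Projective P] : Projective (Pᘁ : C) := by
  refine Projective.of_iso (ρ_ (Pᘁ : C)) ⟨fun {E Z} f e _ => ?_⟩
  have := epi_whiskerLeft e P
  have := projective_tensor_right P Z
  refine ⟨(tensorLeftHomEquiv _ P (Pᘁ : C) _).symm
    (tensorLeftHomEquiv _ P (Pᘁ : C) _ f ≫ Projective.factorThru (𝟙 _) (P ◁ e)), ?_⟩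
  apply (tensorLeftHomEquiv _ P (Pᘁ : C) _).injective
  rw [tensorLeftHomEquiv_naturality, Equiv.apply_symm_apply, Category.assoc,
    Projective.factorThru_comp, Category.comp_id]

lemma projective_leftDual (P : C) [Projective P] : Projective (ᘁP : C) := by
  refine Projective.of_iso (λ_ (ᘁP : C)) ⟨fun {E Z} f e _ => ?_⟩
  have := epi_whiskerRight e P
  have := projective_tensor_left P Z
  refine ⟨(tensorRightHomEquiv _ (ᘁP : C) P _).symm
    (tensorRightHomEquiv _ (ᘁP : C) P _ f ≫ Projective.factorThru (𝟙 _) (e ▷ P)), ?_⟩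
  apply (tensorRightHomEquiv _ (ᘁP : C) P _).injective
  rw [tensorRightHomEquiv_naturality, Equiv.apply_symm_apply, Category.assoc,
    Projective.factorThru_comp, Category.comp_id]

end RigidExact

/-! ### Projectives are injective. -/

section RigidAbelian

variable {C : Type u} [Category.{v} C] [Abelian C] [MonoidalCategory C] [MonoidalPreadditive C]
  [RigidCategory C]

/-- Tensoring with a projective object splits monomorphisms. -/
lemma exists_retraction_whiskerRight {A B : C} (i : A ⟶ B) [Mono i] (Q : C) [Projective Q] :
    ∃ r : B ⊗ Q ⟶ A ⊗ Q, i ▷ Q ≫ r = 𝟙 (A ⊗ Q) := by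
  have := epi_whiskerRight (cokernel.π i) Q
  have := mono_whiskerRight i Q
  have := projective_tensor_left Q (cokernel i)
  let s := Projective.factorThru (𝟙 (cokernel i ⊗ Q)) (cokernel.π i ▷ Q)
  have hs : s ≫ cokernel.π i ▷ Q = 𝟙 _ := Projective.factorThru_comp _ _
  let t : B ⊗ Q ⟶ B ⊗ Q := 𝟙 _ - cokernel.π i ▷ Q ≫ s
  have ht : t ≫ cokernel.π i ▷ Q = 0 := by
    simp only [t, Preadditive.sub_comp, Category.assoc, hs, Category.comp_id, Category.id_comp,
      sub_self]
  have hit : i ▷ Q ≫ t = i ▷ Q := by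
    simp only [t, Preadditive.comp_sub, Category.comp_id]
    rw [← comp_whiskerRight_assoc, cokernel.condition, MonoidalPreadditive.zero_whiskerRight,
      zero_comp, sub_zero]
  -- To lift `t` through `i ▷ Q`, pass to its adjunct with values in `B`: there the lift through `i`
  -- is the kernel property of a monomorphism in an abelian category.
  have ht' : (tensorRightHomEquiv (B ⊗ Q) (ᘁQ : C) Q B).symm t ≫ cokernel.π i = 0 := by
    apply (tensorRightHomEquiv (B ⊗ Q) (ᘁQ : C) Q _).injective
    rw [tensorRightHomEquiv_naturality, Equiv.apply_symm_apply, ht]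
    simp [tensorRightHomEquiv]
  let r' := Abelian.monoLift i _ ht'
  refine ⟨tensorRightHomEquiv (B ⊗ Q) (ᘁQ : C) Q A r', ?_⟩
  rw [← cancel_mono (i ▷ Q), Category.assoc, ← tensorRightHomEquiv_naturality,
    Abelian.monoLift_comp, Equiv.apply_symm_apply, hit, Category.id_comp]

/-- A map `A ⟶ P` is a map `A ⊗ ᘁP ⟶ 𝟙`. It extends along `i` because `ᘁP` is projective, so that
tensoring with it splits `i`. -/
lemma injective_of_projective (P : C) [Projective P] : Injective P := by
  refine Injective.of_iso (λ_ P) ⟨fun {A B} f i _ => ?_⟩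
  have := projective_leftDual P
  obtain ⟨r, hr⟩ := exists_retraction_whiskerRight i (ᘁP : C)
  refine ⟨tensorRightHomEquiv _ (ᘁP : C) P _
    (r ≫ (tensorRightHomEquiv _ (ᘁP : C) P _).symm f), ?_⟩
  apply (tensorRightHomEquiv _ (ᘁP : C) P _).symm.injective
  rw [tensorRightHomEquiv_symm_naturality, Equiv.symm_apply_apply, reassoc_of% hr]

end RigidAbelian

/-! ### The natural family attached to the socle of the cover. -/

section Socle

variable {k : Type w} [Field k] [IsAlgClosed k] {C : Type u} [Category.{v} C] [Abelian C]
  [Linear k C] {G : C}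

lemma IsProjectiveCover.exists_smul_eq (hG : IsFiniteGenerator k G)
    {P S : C} [Simple S] {π : P ⟶ S} (hπ : IsProjectiveCover π) (f : P ⟶ S) :
    ∃ c : k, f = c • π := by
  have := hπ.projective
  have := hπ.epi
  obtain ⟨c, hc⟩ := hπ.exists_scalar hG (Projective.factorThru f π)
  exact ⟨c, by rw [← hc, Projective.factorThru_comp]⟩

/-- A basis of the morphisms from `W` to a simple object, with dual lifts to its projective
cover. -/
lemma IsProjectiveCover.exists_dual_lifts (hG : IsFiniteGenerator k G)
    {P S : C} [Simple S] {π : P ⟶ S} (hπ : IsProjectiveCover π) (W : C) :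
    ∃ (n : ℕ) (b : Fin n → (W ⟶ S)) (a : Fin n → (P ⟶ W)),
      (∀ i j, a j ≫ b i = if i = j then π else 0) ∧
      ∀ f : W ⟶ S, ∃ c : Fin n → k, f = ∑ i, c i • b i := by
  have := hπ.projective
  have := hG.finite_hom P W
  have := hG.finite_hom W S
  obtain ⟨s, hs⟩ : ∃ s : (P ⟶ S) →ₗ[k] k, s π = 1 := by
    obtain ⟨s, hs⟩ := LinearMap.exists_leftInverse_of_injective
      (LinearMap.toSpanSingleton k (P ⟶ S) π)
      (LinearMap.ker_toSpanSingleton k hπ.ne_zero)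
    exact ⟨s, by simpa using congrArg (fun t => t 1) hs⟩
  have hs' : ∀ f : P ⟶ S, f = s f • π := fun f => by
    obtain ⟨c, rfl⟩ := hπ.exists_smul_eq hG f
    rw [map_smul, hs, smul_eq_mul, mul_one]
  let B : (P ⟶ W) →ₗ[k] (W ⟶ S) →ₗ[k] k := (Linear.comp P W S).compr₂ s
  have hB : ∀ a b, B a b = s (a ≫ b) := fun _ _ => rfl
  -- A non-zero `b : W ⟶ S` is epi, so `π` lifts through it and pairs with it to `1`. Finite
  -- dimension then gives preimages under `B` of the dual basis.
  have hinj : Function.Injective B.flip := by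
    rw [← LinearMap.ker_eq_bot, LinearMap.ker_eq_bot']
    intro b hb
    by_contra hb0
    have := epi_of_nonzero_to_simple hb0
    have h1 := LinearMap.congr_fun hb (Projective.factorThru π b)
    rw [LinearMap.flip_apply, hB, Projective.factorThru_comp, hs] at h1
    exact one_ne_zero h1
  have hsurj : Function.Surjective B := LinearMap.flip_injective_iff₁.1 hinj
  let bb := Module.finBasis k (W ⟶ S)
  choose a ha using fun j => hsurj (bb.coord j)
  refine ⟨_, bb, a, fun i j => ?_, fun f => ⟨fun i => bb.repr f i, (bb.sum_repr f).symm⟩⟩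
  rw [hs' (a j ≫ bb i), ← hB, ha, Module.Basis.coord_apply, Module.Basis.repr_self,
    Finsupp.single_apply]
  split_ifs <;> simp

/-- Otherwise `a` is mono, hence split by injectivity of `P`, and `π` factors through `a`. -/
lemma IsProjectiveCover.comp_eq_zero (hG : IsFiniteGenerator k G)
    {P S : C} [Simple S] {π : P ⟶ S} (hπ : IsProjectiveCover π) [Injective P] {D : C} [Simple D]
    {ι : D ⟶ P} (hι : ι ≠ 0) {W : C} (a : P ⟶ W) (ha : ∀ b : W ⟶ S, a ≫ b = 0) : ι ≫ a = 0 := by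
  by_contra h
  have := hπ.mono_of_comp_ne_zero hG ι hι a h
  apply hπ.ne_zero
  rw [← Category.id_comp π, ← Injective.comp_factorThru (𝟙 P) a, Category.assoc, ha]

variable [MonoidalCategory C] [MonoidalPreadditive C] [MonoidalLinear k C] [Simple (𝟙_ C)]

/-- The natural transformation `D ⊗ - ⟶ 𝟭` through multiples of the unit, given by a simple
subobject `D` of the projective cover of the unit. -/
lemma IsProjectiveCover.exists_natural (hG : IsFiniteGenerator k G)
    {P : C} {π : P ⟶ 𝟙_ C} (hπ : IsProjectiveCover π) [Injective P] {D : C} [Simple D]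
    {ι : D ⟶ P} (hι : ι ≠ 0) :
    ∃ ψ : ∀ W : C, D ⊗ W ⟶ W, (∀ {W W' : C} (f : W ⟶ W'), D ◁ f ≫ ψ W' = ψ W ≫ f) ∧
      (∀ W : C, ∃ (n : ℕ) (b : Fin n → (W ⟶ 𝟙_ C)) (a : Fin n → (D ⟶ W)),
        ψ W = ∑ j, D ◁ b j ≫ (ρ_ D).hom ≫ a j) ∧
      ψ P = D ◁ π ≫ (ρ_ D).hom ≫ ι := by
  choose n b a hab hb using fun W => hπ.exists_dual_lifts hG W
  -- After `ι`, a morphism out of `P` depends only on its components against `b W`. This gives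
  -- naturality of `ψ`, and its value at `P` by taking `f = 𝟙 P`.
  have hlift : ∀ {W : C} (f : P ⟶ W) (c : Fin (n W) → k), (∀ i, f ≫ b W i = c i • π) →
      ι ≫ f = ∑ i, c i • (ι ≫ a W i) := by
    intro W f c hf
    have h0 : ι ≫ (f - ∑ i, c i • a W i) = 0 := by
      apply hπ.comp_eq_zero hG hι
      intro g
      obtain ⟨d, rfl⟩ := hb W g
      rw [Preadditive.comp_sum]
      refine Finset.sum_eq_zero fun i _ => ?_
      rw [Linear.comp_smul, Preadditive.sub_comp, hf, Preadditive.sum_comp]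
      simp [hab]
    rw [Preadditive.comp_sub, sub_eq_zero] at h0
    rw [h0, Preadditive.comp_sum]
    simp
  refine ⟨fun W => ∑ j, D ◁ b W j ≫ (ρ_ D).hom ≫ ι ≫ a W j, ?_,
    fun W => ⟨n W, b W, fun j => ι ≫ a W j, rfl⟩, ?_⟩
  · intro W W' f
    choose m hm using fun i => hb W (f ≫ b W' i)
    have h1 : ∀ j, ι ≫ a W j ≫ f = ∑ i, m i j • (ι ≫ a W' i) := by
      intro j
      apply hlift
      intro i
      rw [Category.assoc, hm, Preadditive.comp_sum]
      simp [hab]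
    rw [Preadditive.comp_sum, Preadditive.sum_comp]
    simp only [Category.assoc, h1, ← MonoidalCategory.whiskerLeft_comp_assoc, hm]
    simp only [whiskerLeft_sum, Preadditive.sum_comp, Preadditive.comp_sum,
      MonoidalLinear.whiskerLeft_smul, Linear.smul_comp, Linear.comp_smul]
    exact Finset.sum_comm
  · choose m hm using fun j => hπ.exists_smul_eq hG (b P j)
    have h1 : ι = ∑ j, m j • (ι ≫ a P j) := by
      have := hlift (𝟙 P) m fun i => by rw [Category.id_comp, hm]
      rwa [Category.comp_id] at this
    calc ∑ j, D ◁ b P j ≫ (ρ_ D).hom ≫ ι ≫ a P j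
        = ∑ j, D ◁ π ≫ (ρ_ D).hom ≫ (m j • (ι ≫ a P j)) := by
          refine Finset.sum_congr rfl fun j _ => ?_
          rw [hm j, MonoidalLinear.whiskerLeft_smul, Linear.smul_comp, Linear.comp_smul,
            Linear.comp_smul]
      _ = _ := by rw [← Preadditive.comp_sum, ← Preadditive.comp_sum, ← h1]

end Socle

/-! ### Integrals from actions through the unit. -/

section Integrals

variable {C : Type u} [Category.{v} C] [Preadditive C] [MonoidalCategory C] [MonoidalPreadditive C]
  [RigidCategory C] [BraidedCategory C] [HasCoend (dualTensor C)]

/-- A morphism `D ⊗ W ⟶ W` that factors through a finite sum of copies of the unit. -/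
def FactorsThroughUnits {D W : C} (φ : D ⊗ W ⟶ W) : Prop :=
  ∃ (n : ℕ) (b : Fin n → (W ⟶ 𝟙_ C)) (a : Fin n → (D ⟶ W)),
    φ = ∑ j, D ◁ b j ≫ (ρ_ D).hom ≫ a j

/-- By naturality, encircling `W` before a map `W ⟶ 𝟙` is encircling `𝟙`, which is the counit. -/
lemma FactorsThroughUnits.whiskerLeft_encircle_comp {D W : C} {φ : D ⊗ W ⟶ W}
    (hφ : FactorsThroughUnits φ) :
    D ◁ encircle W ≫ φ = (α_ _ _ _).inv ≫ (D ◁ coendCounit ≫ (ρ_ D).hom) ▷ W ≫ φ := by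
  obtain ⟨n, b, a, rfl⟩ := hφ
  simp only [Preadditive.comp_sum]
  refine Finset.sum_congr rfl fun j _ => ?_
  rw [← MonoidalCategory.whiskerLeft_comp_assoc, ← encircle_naturality, encircle_unit,
    ← whisker_exchange_assoc]
  simp

lemma FactorsThroughUnits.whiskerLeft_comp_encircle {W : C} {φ : 𝟙_ C ⊗ W ⟶ W}
    (hφ : FactorsThroughUnits φ) :
    coendObj C ◁ φ ≫ encircle W = coendCounit ▷ (𝟙_ C ⊗ W) ≫ (λ_ _).hom ≫ φ := by
  obtain ⟨n, b, a, rfl⟩ := hφ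
  simp only [whiskerLeft_sum, Preadditive.comp_sum, Preadditive.sum_comp]
  refine Finset.sum_congr rfl fun j _ => ?_
  have h : coendObj C ◁ a j ≫ encircle W = (ρ_ _).hom ≫ coendCounit ≫ a j := by
    rw [encircle_naturality, encircle_unit, Category.assoc]
  calc _ = coendObj C ◁ (𝟙_ C ◁ b j ≫ (ρ_ (𝟙_ C)).hom) ≫ coendObj C ◁ a j ≫ encircle W := by simp
    _ = 𝟙 _ ⊗≫ (coendObj C ◁ b j ≫ coendCounit ▷ 𝟙_ C) ⊗≫ a j := by rw [h]; monoidal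
    _ = _ := by rw [whisker_exchange]; monoidal

lemma isRightIntegralFrom_of_factorsThroughUnits
    (hω : IsIso (pairingToDual (hopfPairing (C := C)))) {D : C} {Λ : D ⟶ coendObj C}
    (h : ∀ V : C, FactorsThroughUnits (Λ ▷ (Vᘁ : C) ≫ encircle (Vᘁ : C))) :
    IsRightIntegralFrom Λ := by
  apply encircle_ext hω
  intro V
  rw [comp_whiskerRight_assoc, encircle_mul, associator_naturality_left_assoc,
    ← whisker_exchange_assoc, (h V).whiskerLeft_encircle_comp, Iso.hom_inv_id_assoc]
  simp

lemma isLeftIntegral_of_factorsThroughUnits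
    (hω : IsIso (pairingToDual (hopfPairing (C := C)))) {Λ : 𝟙_ C ⟶ coendObj C}
    (h : ∀ V : C, FactorsThroughUnits (Λ ▷ (Vᘁ : C) ≫ encircle (Vᘁ : C))) :
    IsLeftIntegral Λ := by
  apply encircle_ext hω
  intro V
  rw [comp_whiskerRight_assoc, encircle_mul, associator_naturality_middle_assoc,
    ← MonoidalCategory.whiskerLeft_comp_assoc, (h V).whiskerLeft_comp_encircle]
  monoidal

end Integrals

/-! ### Self-duality of the cover. -/

section SelfDual

variable {k : Type w} [Field k] [IsAlgClosed k] {C : Type u} [Category.{v} C] [Abelian C]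
  [Linear k C] [MonoidalCategory C] [MonoidalPreadditive C] [Simple (𝟙_ C)] [RigidCategory C]
  {G : C}

/-- A projective cover of the unit with the unit as a subobject is self-dual. -/
lemma IsProjectiveCover.nonempty_dual_iso (hG : IsFiniteGenerator k G) {P : C} {π : P ⟶ 𝟙_ C}
    (hπ : IsProjectiveCover π) {ι : 𝟙_ C ⟶ P} (hι : ι ≠ 0) : Nonempty ((Pᘁ : C) ≅ P) := by
  have := hπ.projective
  have := hπ.epi
  have := injective_of_projective P
  have := projective_rightDual P
  let u : ((𝟙_ C)ᘁ : C) ≅ 𝟙_ C := rightDualIso HasRightDual.exact exactPairingUnit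
  let κ : (Pᘁ : C) ⟶ 𝟙_ C := ιᘁ ≫ u.hom
  have hιd : ιᘁ ≠ 0 := by
    intro h0
    apply hι
    apply eval_ext_left
    rw [← rightAdjointMate_comp_evaluation, h0]
    simp
  have hκ : κ ≠ 0 := fun h0 => hιd (by rw [← cancel_mono u.hom, zero_comp]; exact h0)
  have := epi_of_nonzero_to_simple hκ
  let t : P ⟶ (Pᘁ : C) := Projective.factorThru π κ
  let s : (Pᘁ : C) ⟶ P := Projective.factorThru κ π
  have ht : t ≫ κ = π := Projective.factorThru_comp _ _
  have hs : s ≫ π = κ := Projective.factorThru_comp _ _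
  have hts : IsIso (t ≫ s) :=
    hπ.isIso_of_ne_zero hG _ (by rw [Category.assoc, hs, ht]; exact hπ.ne_zero)
  -- `Pᘁ` is not known to be a cover, so return to `P`: `s ≫ t` is the mate of some `y`, and `s ≫ t
  -- ≫ κ = κ` says that `y` fixes `ι`. Then `y` is mono by the socle property, hence invertible.
  have hst : IsIso (s ≫ t) := by
    obtain ⟨y, hy⟩ := exists_rightAdjointMate_eq (s ≫ t)
    have hιy : ι ≫ y = ι := by
      have h1 : (ι ≫ y)ᘁ = ιᘁ := by
        rw [comp_rightAdjointMate, hy, ← cancel_mono u.hom, Category.assoc, Category.assoc]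
        change s ≫ t ≫ κ = κ
        rw [ht, hs]
      apply eval_ext_left
      rw [← rightAdjointMate_comp_evaluation, h1, rightAdjointMate_comp_evaluation]
    have := hπ.mono_of_comp_ne_zero hG ι hι y (by rwa [hιy])
    have := hG.isIso_of_mono y
    rw [← hy]
    exact ⟨(inv y)ᘁ, by rw [← comp_rightAdjointMate]; simp, by rw [← comp_rightAdjointMate]; simp⟩
  have : Mono s := mono_of_mono s t
  have : Epi s := epi_of_epi t s
  have := isIso_of_mono_of_epi s
  exact ⟨asIso s⟩

end SelfDual

/-! ### The factorizable case. -/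

section Modular

variable {k : Type w} [Field k] [IsAlgClosed k] {C : Type u} [Category.{v} C] [Abelian C]
  [Linear k C] [MonoidalCategory C] [MonoidalPreadditive C] [MonoidalLinear k C] [Simple (𝟙_ C)]
  [RigidCategory C] [BraidedCategory C] [HasCoend (dualTensor C)] {G : C}

lemma IsProjectiveCover.exists_integral (hG : IsFiniteGenerator k G)
    (hω : IsIso (pairingToDual (hopfPairing (C := C)))) {P : C} {π : P ⟶ 𝟙_ C}
    (hπ : IsProjectiveCover π) {D : C} [Simple D] {ι : D ⟶ P} (hι : ι ≠ 0) :
    ∃ Λ : D ⟶ coendObj C, Λ ≠ 0 ∧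
      ∀ V : C, FactorsThroughUnits (Λ ▷ (Vᘁ : C) ≫ encircle (Vᘁ : C)) := by
  have := hπ.projective
  have := hπ.epi
  have := injective_of_projective P
  obtain ⟨ψ, hnat, hfac, hP⟩ := hπ.exists_natural hG hι
  obtain ⟨Λ, hΛ⟩ := exists_encircle_eq hω ψ hnat
  refine ⟨Λ, fun h0 => hι ?_, fun V => by rw [hΛ]; exact hfac _⟩
  obtain ⟨V, ⟨i⟩⟩ := exists_iso_rightDual P
  -- If `Λ = 0` then `ψ` vanishes on all `Vᘁ`, and `P` is isomorphic to one of these; but `ψ P` is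
  -- `ι` after an epimorphism.
  have hz : ψ P = 0 := by
    rw [← cancel_mono i.hom, ← hnat, ← hΛ, h0, MonoidalPreadditive.zero_whiskerRight]
    simp
  rw [hP] at hz
  have := epi_whiskerLeft π D
  rw [← cancel_epi (D ◁ π ≫ (ρ_ D).hom), comp_zero, Category.assoc, hz]

variable [RibbonCategory C]

/-- In the factorizable case the unit embeds into its projective cover. -/
lemma IsProjectiveCover.exists_unit_mono (hG : IsFiniteGenerator k G)
    (hω : IsIso (pairingToDual (hopfPairing (C := C)))) {P : C} {π : P ⟶ 𝟙_ C}
    (hπ : IsProjectiveCover π) : ∃ ι : 𝟙_ C ⟶ P, ι ≠ 0 := by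
  have hP : ¬ IsZero P := fun h => hπ.ne_zero (h.eq_of_src _ _)
  obtain ⟨D, ι, _, _⟩ := hG.exists_simple hP
  have hι : ι ≠ 0 := fun h0 => by
    subst h0
    exact Simple.not_isZero D (IsZero.of_mono_zero D P)
  obtain ⟨Λ, hΛ, hfac⟩ := hπ.exists_integral hG hω hι
  have hR := isRightIntegralFrom_of_factorsThroughUnits hω hfac
  have := isIso_of_hom_simple (f := Λ ≫ coendTwist.inv ≫ coendCounit)
    fun h0 => hΛ (hR.eq_zero_of_twist_inv hω h0)
  refine ⟨inv (Λ ≫ coendTwist.inv ≫ coendCounit) ≫ ι, fun h0 => hι ?_⟩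
  rwa [← cancel_epi (inv (Λ ≫ coendTwist.inv ≫ coendCounit)), comp_zero]

lemma IsProjectiveCover.twistNondegenerate (hG : IsFiniteGenerator k G)
    (hω : IsIso (pairingToDual (hopfPairing (C := C)))) {P : C} {π : P ⟶ 𝟙_ C}
    (hπ : IsProjectiveCover π) :
  (∃ Λ : 𝟙_ C ⟶ coendObj C, Λ ≠ 0 ∧ IsRightIntegral Λ ∧ IsLeftIntegral Λ) ∧
  ∀ Λ : 𝟙_ C ⟶ coendObj C, Λ ≠ 0 → (IsRightIntegral Λ ∨ IsLeftIntegral Λ) →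
    ∃ Δp Δm : k, Δp ≠ 0 ∧ Δm ≠ 0 ∧
      Λ ≫ coendTwist.hom ≫ coendCounit = Δp • 𝟙 (𝟙_ C) ∧
      Λ ≫ coendTwist.inv ≫ coendCounit = Δm • 𝟙 (𝟙_ C) := by
  obtain ⟨ι, hι⟩ := hπ.exists_unit_mono hG hω
  obtain ⟨Λ₀, hΛ₀, hfac⟩ := hπ.exists_integral hG hω hι
  have hR := isRightIntegralFrom_of_factorsThroughUnits hω hfac
  have hL := isLeftIntegral_of_factorsThroughUnits hω hfac
  have := hG.finite_hom (𝟙_ C) (𝟙_ C)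
  refine ⟨⟨Λ₀, hΛ₀, hR.isRightIntegral, hL⟩, fun Λ hΛ hint => ?_⟩
  have hΛR : IsRightIntegralFrom Λ := by
    rcases hint with h | h
    · exact h.isRightIntegralFrom
    obtain ⟨c, hc⟩ := endomorphism_simple_eq_smul_id k (Λ₀ ≫ coendTwist.inv ≫ coendCounit)
    obtain ⟨d, hd⟩ := endomorphism_simple_eq_smul_id k (Λ ≫ coendTwist.inv ≫ coendCounit)
    have hc0 : c ≠ 0 := fun h0 => hΛ₀ (hR.eq_zero_of_twist_inv hω (by rw [← hc, h0, zero_smul]))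
    -- The coefficient `d / c` is chosen so that `ε ∘ T⁻¹` kills the difference. Hence `Λ` is a
    -- multiple of `Λ₀`, and so a right integral.
    have hdiff : IsLeftIntegral (Λ + (-(d / c)) • Λ₀) := by
      unfold IsLeftIntegral at h hL ⊢
      simp only [MonoidalPreadditive.whiskerLeft_add, MonoidalLinear.whiskerLeft_smul,
        Preadditive.add_comp, Preadditive.comp_add, Linear.smul_comp, Linear.comp_smul, h, hL]
    have hzero := hdiff.eq_zero_of_twist_inv hω (by
      rw [Preadditive.add_comp, Linear.smul_comp, ← hc, ← hd, smul_smul, neg_mul,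
        div_mul_cancel₀ _ hc0, neg_smul, add_neg_cancel])
    rw [eq_neg_of_add_eq_zero_left hzero, ← neg_smul, neg_neg]
    unfold IsRightIntegralFrom at hR ⊢
    simp only [MonoidalLinear.smul_whiskerRight, Linear.smul_comp, Linear.comp_smul, hR]
  obtain ⟨c, hc⟩ := endomorphism_simple_eq_smul_id k (Λ ≫ coendTwist.hom ≫ coendCounit)
  obtain ⟨d, hd⟩ := endomorphism_simple_eq_smul_id k (Λ ≫ coendTwist.inv ≫ coendCounit)
  exact ⟨c, d, fun h0 => hΛ (hΛR.eq_zero_of_twist_hom hω (by rw [← hc, h0, zero_smul])),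
    fun h0 => hΛ (hΛR.eq_zero_of_twist_inv hω (by rw [← hd, h0, zero_smul])), hc.symm, hd.symm⟩

end Modular

/-- The one axiom of an abelian category not supplied by `exists_abelian_generator`. -/
lemma isNormalMonoCategory (k : Type w) [Field k] (C : Type u) [Category.{v} C] [Preadditive C]
    [Linear k C] [FiniteLinearCategory k C] : IsNormalMonoCategory C := by
  obtain ⟨A, _, _, _, e, _, _⟩ := FiniteLinearCategory.exists_equivalence (k := k) (C := C)
  have : IsNoetherianRing A := isNoetherian_of_tower k inferInstance
  have h1 : HasFiniteProducts C :=
    ⟨fun _ => Adjunction.hasLimitsOfShape_of_equivalence e.functor⟩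
  let hA : Abelian C := abelianOfEquivalence e.functor
  infer_instance

end RibbonCat

end

theorem propositionP (k : Type w) [Field k] [IsAlgClosed k]
    (C : Type u) [Category.{v} C] [Preadditive C] [Linear k C]
    [RibbonCat.FiniteLinearCategory k C]
    [MonoidalCategory C] [MonoidalPreadditive C] [MonoidalLinear k C] [Simple (𝟙_ C)]
    [RigidCategory C] [BraidedCategory C] [RibbonCat.RibbonCategory C]
    (hC : RibbonCat.Factorizable k C) :
    RibbonCat.Unimodular C ∧ RibbonCat.TwistNondegenerate k C := by
  have := RibbonCat.hasCoend_dualTensor k C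
  have := RibbonCat.isNormalMonoCategory k C
  obtain ⟨G, hG, _, _, _, _⟩ := RibbonCat.exists_abelian_generator k C
  -- Assembled from the propositional pieces over the given additive structure, with which the
  -- monoidal and linear hypotheses are stated.
  let _ : Abelian C := { }
  obtain ⟨P, π, hπ⟩ := hG.exists_projectiveCover (𝟙_ C)
  obtain ⟨ι, hι⟩ := hπ.exists_unit_mono hG hC
  exact ⟨⟨P, π, hπ, hπ.nonempty_dual_iso hG hι⟩, hπ.twistNondegenerate hG hC⟩
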